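/- Let $K$ be a field of characteristic $0$ and $t\in K$ (for instance $K=\mathbb{Q}(t)$), and let $\Lambda$ be the algebra of symmetric functions over $K$ in $X=x_1+x_2+\cdots$, with power sums $p_k$, complete homogeneous functions $h_n$, Schur functions $s_\mu$, the standard scalar product $\langle p_\lambda,p_\mu\rangle=z_\lambda\delta_{\lambda\mu}$ where $z_\lambda=\prod_k k^{n_k}n_k!$ and $n_k$ is the number of parts of $\lambda$ equal to $k$, and the involution $\omega(p_k)=(-1)^{k-1}p_k$. For $f\in\Lambda$ let $f^\perp$ be the adjoint of multiplication by $f$. For $P\in\Lambda$, $P[E]$ denotes plethystic substitution: expand $P$ in power sums and replace each $p_k$ by $p_k[E]$, which is $E$ with every variable replaced by its $k$-th power. Write $\Omega=\sum_{n\ge0}h_n$. For $a\in\mathbb{Z}$ put $$S_aP[X]=P\left[X-\tfrac1z\right]\Omega[zX]\Big|_{z^a},\qquad \tilde S_a=\omega S_a\omega .$$ For a nonempty partition $\lambda$ let $\lambda^{rc}=(\lambda_2-1,\ldots,\lambda_{\ell(\lambda)}-1)$ be $\lambda$ with its first row and first column removed. A ribbon $R$ of size $m$, written $R\models m$, is a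 skew diagram $R=\lambda/\lambda^{rc}$ with $\lambda_1+\ell(\lambda)-1=m$. Diagrams are drawn with the first row at the bottom. Label the cells of $R$ by $1,\ldots,m$ from left to right and top to bottom; let $D(R)$ be the set of those $i$ for which cell $i+1$ lies below cell $i$, and let $$\mathrm{maj}(R)=\sum_{i\in D(R)}i,\qquad \mathrm{comaj}(R)=\binom m2-\mathrm{maj}(R).$$ Put $S^R=s_{\lambda^{rc}}^\perp\,\tilde S_{\lambda'_1}\tilde S_{\lambda'_2}\cdots\tilde S_{\lambda'_{\lambda_1}}$, where $\lambda'_i$ is the length of the $i$-th column of $\lambda$, and $$H^t_{1^m}=\sum_{R\models m}t^{\mathrm{comaj}(R)}S^R .$$ Then for every $m\ge1$ and every $P\in\Lambda$, with $Z^*=\sum_{i=1}^m 1/z_i$, $$H^t_{1^m}P[X]=P[X+Z^*]\prod_{i=1}^m\bigl(1-t^{i-1}\Omega[-z_iX]\bigr)\prod_{1\le i<j\le m}\bigl(1-z_j/z_i\bigr)\Big|_{z_1z_2\cdots z_m},$$ the coefficient of $z_1z_2\cdots z_m$ in the formal series in $z_1,\ldots,z_m$ (with finitely many negative powers) over $\Lambda$,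 where $p_k[X+Z^*]=p_k+\sum_i z_i^{-k}$ and $\Omega[-z_iX]=\sum_{n\ge0}z_i^n\,h_n[-X]$ with $p_k[-X]=-p_k$. -/

import Mathlib

namespace RibbonOperators

/-- The algebra of symmetric functions over `K` in the variables `x_0, x_1, …`: the formal power
series of bounded degree that are invariant under all permutations of the variables. -/
noncomputable def SymFn (K : Type*) [CommRing K] : Subalgebra K (MvPowerSeries ℕ K) where
  carrier := {f | (∃ N : ℕ, ∀ d : ℕ →₀ ℕ, N < d.degree → MvPowerSeries.coeff d f = 0) ∧
    ∀ σ : Equiv.Perm ℕ, MvPowerSeries.renameEquiv K σ f = f}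
  mul_mem' := by
    rintro f g ⟨⟨N, hN⟩, hf⟩ ⟨⟨M, hM⟩, hg⟩
    refine ⟨⟨N + M, fun d hd => ?_⟩, fun σ => by rw [map_mul, hf, hg]⟩
    classical
    rw [MvPowerSeries.coeff_mul]
    refine Finset.sum_eq_zero fun x hx => ?_
    rw [Finset.HasAntidiagonal.mem_antidiagonal] at hx
    rw [← hx, map_add] at hd
    rcases Nat.lt_or_ge N x.1.degree with h | h
    · rw [hN _ h, zero_mul]
    · rw [hM x.2 (by omega), mul_zero]
  add_mem' := by
    rintro f g ⟨⟨N, hN⟩, hf⟩ ⟨⟨M, hM⟩, hg⟩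
    refine ⟨⟨N + M, fun d hd => ?_⟩, fun σ => by rw [map_add, hf, hg]⟩
    rw [map_add, hN d (by omega), hM d (by omega), add_zero]
  algebraMap_mem' := by
    intro r
    refine ⟨⟨0, fun d hd => ?_⟩, fun σ => AlgEquiv.commutes _ r⟩
    classical
    rw [MvPowerSeries.algebraMap_apply, MvPowerSeries.coeff_C, if_neg]
    rintro rfl
    simp at hd

theorem coeff_renameEquiv {K : Type*} [CommRing K] (σ : Equiv.Perm ℕ) (f : MvPowerSeries ℕ K)
    (d : ℕ →₀ ℕ) : MvPowerSeries.coeff (d.equivMapDomain σ) (MvPowerSeries.renameEquiv K σ f) =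
      MvPowerSeries.coeff d f := by
  have h := MvPowerSeries.coeff_embDomain_rename (R := K) σ.toEmbedding f d
  rw [← h, Finsupp.embDomain_eq_mapDomain, Finsupp.equivMapDomain_eq_mapDomain]
  rfl

/-- A bounded-degree series is a symmetric function as soon as its coefficients are invariant. -/
theorem mem_symFn {K : Type*} [CommRing K] (f : MvPowerSeries ℕ K) (N : ℕ)
    (hN : ∀ d : ℕ →₀ ℕ, N < d.degree → MvPowerSeries.coeff d f = 0)
    (hs : ∀ (σ : Equiv.Perm ℕ) (d : ℕ →₀ ℕ),
      MvPowerSeries.coeff (d.equivMapDomain σ) f = MvPowerSeries.coeff d f) : f ∈ SymFn K := by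
  refine ⟨⟨N, hN⟩, fun σ => ?_⟩
  ext d
  have h := coeff_renameEquiv σ f (d.equivMapDomain σ.symm)
  have e : (d.equivMapDomain σ.symm).equivMapDomain σ = d := by
    ext i; simp
  rw [e] at h
  rw [h, hs]

theorem coeff_equivMapDomain {K : Type*} [CommRing K] (f : SymFn K) (σ : Equiv.Perm ℕ)
    (d : ℕ →₀ ℕ) : MvPowerSeries.coeff (d.equivMapDomain σ) (f : MvPowerSeries ℕ K) =
      MvPowerSeries.coeff d (f : MvPowerSeries ℕ K) := by
  rw [← coeff_renameEquiv σ (f : MvPowerSeries ℕ K) d, f.2.2 σ]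

/-- The series `∑ i, x_i ^ k`. -/
noncomputable def psumSeries (R : Type*) [Semiring R] (k : ℕ) : MvPowerSeries ℕ R :=
  open Classical in fun d => if ∃ i, d = Finsupp.single i k then 1 else 0

open Classical in
theorem coeff_psumSeries (R : Type*) [Semiring R] (k : ℕ) (d : ℕ →₀ ℕ) :
    MvPowerSeries.coeff d (psumSeries R k) = if ∃ i, d = Finsupp.single i k then 1 else 0 := rfl

theorem degree_equivMapDomain (σ : Equiv.Perm ℕ) (d : ℕ →₀ ℕ) :
    (d.equivMapDomain σ).degree = d.degree := by
  rw [Finsupp.equivMapDomain_eq_mapDomain, Finsupp.degree_mapDomain]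

theorem psumSeries_mem {K : Type*} [CommRing K] (k : ℕ) : psumSeries K k ∈ SymFn K := by
  classical
  refine mem_symFn _ k (fun d hd => ?_) (fun σ d => ?_)
  · rw [coeff_psumSeries, if_neg]
    rintro ⟨i, rfl⟩
    simp at hd
  · simp only [coeff_psumSeries]
    refine if_congr ⟨?_, ?_⟩ rfl rfl
    · rintro ⟨i, hi⟩
      refine ⟨σ.symm i, ?_⟩
      have := congrArg (Finsupp.equivMapDomain σ.symm) hi
      rw [Finsupp.equivMapDomain_single] at this
      rw [← this]; ext j; simp
    · rintro ⟨i, rfl⟩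
      exact ⟨σ i, Finsupp.equivMapDomain_single _ _ _⟩

/-- The power sum `p_k`. -/
noncomputable def psum (K : Type*) [CommRing K] (k : ℕ+) : SymFn K :=
  ⟨psumSeries K k, psumSeries_mem k⟩

/-- The complete homogeneous symmetric function `h_n`, the sum of all monomials of degree `n`. -/
noncomputable def hsymm (K : Type*) [CommRing K] (n : ℕ) : SymFn K :=
  ⟨fun d => if d.degree = n then 1 else 0, mem_symFn _ n
    (fun d hd => if_neg (by omega))
    (fun σ d => if_congr (by rw [degree_equivMapDomain]) rfl rfl)⟩

/-- The multiset of nonzero exponents of a monomial. -/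
def parts (d : ℕ →₀ ℕ) : Multiset ℕ := d.support.val.map d

theorem parts_single_add {i k : ℕ} {b : ℕ →₀ ℕ} (hk : 0 < k) (hb : b i = 0) :
    parts (Finsupp.single i k + b) = k ::ₘ parts b := by
  classical
  have hs : (Finsupp.single i k + b).support = insert i b.support := by
    ext j
    by_cases hj : j = i
    · subst hj; simp; omega
    · simp [hj]
  have hi : i ∉ b.support := by simpa using hb
  unfold parts
  rw [hs, Finset.insert_val_of_notMem hi, Multiset.map_cons]
  congr 1
  · simp [hb]
  · refine Multiset.map_congr rfl fun j hj => ?_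
    have : j ≠ i := by rintro rfl; exact hi hj
    simp [this]

theorem exists_of_coeff_psum_mul {R : Type*} [CommSemiring R] {k : ℕ} {g : MvPowerSeries ℕ R}
    {d : ℕ →₀ ℕ} (hd : MvPowerSeries.coeff d (psumSeries R k * g) ≠ 0) :
    ∃ i b, d = Finsupp.single i k + b ∧ MvPowerSeries.coeff b g ≠ 0 := by
  classical
  rw [MvPowerSeries.coeff_mul] at hd
  obtain ⟨x, hx, hne⟩ := Finset.exists_ne_zero_of_sum_ne_zero hd
  rw [Finset.HasAntidiagonal.mem_antidiagonal] at hx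
  rw [coeff_psumSeries] at hne
  split_ifs at hne with hi
  · obtain ⟨i, hi⟩ := hi
    exact ⟨i, x.2, by rw [← hi, hx], by simpa using hne⟩
  · simp at hne

theorem coeff_prod_psum (s : Multiset ℕ) (hs : ∀ k ∈ s, 0 < k) : ∀ d : ℕ →₀ ℕ,
    (MvPowerSeries.coeff d (s.map (psumSeries ℕ)).prod ≠ 0 → d.degree = s.sum ∧
      d.support.card ≤ s.card ∧ (d.support.card = s.card → parts d = s)) ∧
    (parts d = s → MvPowerSeries.coeff d (s.map (psumSeries ℕ)).prod ≠ 0) := by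
  classical
  induction s using Multiset.induction_on with
  | empty =>
    intro d
    have key : d = 0 ↔ parts d = 0 := by
      simp [parts]
    rw [← key]
    simp only [Multiset.map_zero, Multiset.prod_zero, MvPowerSeries.coeff_one]
    refine ⟨fun h => ?_, fun h => by simp [h]⟩
    have : d = 0 := by by_contra h0; simp [h0] at h
    subst this; simp
  | cons k s ih =>
    have hk : 0 < k := hs k (Multiset.mem_cons_self _ _)
    have ih := ih fun j hj => hs j (Multiset.mem_cons_of_mem hj)
    intro d
    rw [Multiset.map_cons, Multiset.prod_cons, Multiset.sum_cons, Multiset.card_cons]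
    constructor
    · intro hd
      obtain ⟨i, b, rfl, hb⟩ := exists_of_coeff_psum_mul hd
      obtain ⟨h1, h2, h3⟩ := (ih b).1 hb
      refine ⟨by simp [h1], ?_⟩
      by_cases hbi : b i = 0
      · have hp := parts_single_add hk hbi
        have hc : (Finsupp.single i k + b).support.card = b.support.card + 1 := by
          have := congrArg Multiset.card hp
          simpa [parts] using this
        rw [hc]
        refine ⟨by omega, fun h => ?_⟩
        rw [hp, h3 (by omega)]
      · have hsupp : (Finsupp.single i k + b).support = b.support := by
          ext j
          by_cases hj : j = i
          · subst hj; simp [hbi]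
          · simp [Ne.symm hj]
        rw [hsupp]
        exact ⟨by omega, fun h => by omega⟩
    · intro hd
      have hmem : k ∈ parts d := by rw [hd]; exact Multiset.mem_cons_self _ _
      obtain ⟨i, hi, hik⟩ := Multiset.mem_map.1 hmem
      have hde : Finsupp.single i k + d.erase i = d := by
        rw [← hik]; exact Finsupp.single_add_erase i d
      have hpe : parts (d.erase i) = s := by
        have h1 := parts_single_add (b := d.erase i) (i := i) hk (by simp)
        rw [hde, hd] at h1
        exact ((Multiset.cons_inj_right k).1 h1).symm
      rw [MvPowerSeries.coeff_mul]
      intro h0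
      rw [Finset.sum_eq_zero_iff] at h0
      have h1 := h0 (Finsupp.single i k, d.erase i) (Finset.HasAntidiagonal.mem_antidiagonal.2 hde)
      rw [coeff_psumSeries, if_pos ⟨i, rfl⟩, one_mul] at h1
      exact (ih _).2 hpe h1

/-- The product `p_s` of the power sums indexed by a multiset `s`. -/
noncomputable def pProd (K : Type*) [CommRing K] (s : Multiset ℕ) : SymFn K :=
  (s.map fun k => (⟨psumSeries K k, psumSeries_mem k⟩ : SymFn K)).prod

theorem coeff_pProd {K : Type*} [CommRing K] (s : Multiset ℕ) (d : ℕ →₀ ℕ) :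
    MvPowerSeries.coeff d (pProd K s : MvPowerSeries ℕ K) =
      ((MvPowerSeries.coeff d (s.map (psumSeries ℕ)).prod : ℕ) : K) := by
  have h1 : ∀ k, MvPowerSeries.map (Nat.castRingHom K) (psumSeries ℕ k) = psumSeries K k := by
    intro k
    ext d
    classical
    rw [MvPowerSeries.coeff_map, coeff_psumSeries, coeff_psumSeries]
    split_ifs <;> simp
  have h2 : (pProd K s : MvPowerSeries ℕ K) =
      MvPowerSeries.map (Nat.castRingHom K) (s.map (psumSeries ℕ)).prod := by
    rw [pProd, map_multiset_prod, Multiset.map_map]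
    change (SymFn K).val _ = _
    rw [map_multiset_prod, Multiset.map_map]
    congr 1
    refine Multiset.map_congr rfl fun k _ => ?_
    simp [h1]
  rw [h2, MvPowerSeries.coeff_map]
  rfl

/-- Two monomials with the same exponents differ by a permutation of the variables. -/
theorem exists_perm_of_parts_eq {d d' : ℕ →₀ ℕ} (hd : parts d = parts d') :
    ∃ σ : Equiv.Perm ℕ, d.equivMapDomain σ = d' := by
  classical
  have key : ∀ c : ℕ, Nonempty ({a // d a = c} ≃ {a // d' a = c}) := by
    intro c
    by_cases hc : c = 0
    · subst hc
      have inf : ∀ e : ℕ →₀ ℕ, Infinite {a // e a = 0} := by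
        intro e
        have : ((e.support : Set ℕ)ᶜ).Infinite := e.support.finite_toSet.infinite_compl
        have h2 : ((e.support : Set ℕ)ᶜ) = {a | e a = 0} := by ext a; simp
        rw [h2] at this
        exact this.to_subtype
      have := inf d
      have := inf d'
      obtain ⟨i1⟩ := nonempty_denumerable {a // d a = 0}
      obtain ⟨i2⟩ := nonempty_denumerable {a // d' a = 0}
      exact ⟨Denumerable.equiv₂ _ _⟩
    · have cnt : ∀ e : ℕ →₀ ℕ, Nonempty ({a // e a = c} ≃ Fin ((parts e).count c)) := by
        intro e
        have h1 : ∀ a, e a = c ↔ a ∈ e.support.filter (fun a => c = e a) := by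
          intro a
          simp only [Finset.mem_filter, Finsupp.mem_support_iff]
          constructor
          · rintro rfl; exact ⟨hc, rfl⟩
          · rintro ⟨_, h⟩; exact h.symm
        have h2 : (parts e).count c = (e.support.filter (fun a => c = e a)).card := by
          rw [parts, Multiset.count_map]; rfl
        rw [h2]
        exact ⟨(Equiv.subtypeEquivRight h1).trans (Finset.equivFin _)⟩
      obtain ⟨e1⟩ := cnt d
      obtain ⟨e2⟩ := cnt d'
      exact ⟨e1.trans ((finCongr (by rw [hd])).trans e2.symm)⟩
  refine ⟨Equiv.ofFiberEquiv fun c => (key c).some, ?_⟩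
  ext j
  rw [Finsupp.equivMapDomain_apply]
  have := Equiv.ofFiberEquiv_map (fun c => (key c).some)
    ((Equiv.ofFiberEquiv fun c => (key c).some).symm j)
  rw [Equiv.apply_symm_apply] at this
  exact this.symm

theorem exists_parts_eq (s : Multiset ℕ) (hs : ∀ k ∈ s, 0 < k) : ∃ d : ℕ →₀ ℕ, parts d = s := by
  classical
  induction s using Multiset.induction_on with
  | empty => exact ⟨0, by simp [parts]⟩
  | cons k s ih =>
    obtain ⟨b, rfl⟩ := ih fun j hj => hs j (Multiset.mem_cons_of_mem hj)
    obtain ⟨i, hi⟩ := Infinite.exists_notMem_finset b.support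
    exact ⟨Finsupp.single i k + b,
      parts_single_add (hs k (Multiset.mem_cons_self _ _)) (by simpa using hi)⟩

theorem card_parts (d : ℕ →₀ ℕ) : (parts d).card = d.support.card := by simp [parts]

theorem sum_parts (d : ℕ →₀ ℕ) : (parts d).sum = d.degree := rfl

theorem pos_of_mem_parts {d : ℕ →₀ ℕ} {k : ℕ} (hk : k ∈ parts d) : 0 < k := by
  obtain ⟨i, hi, rfl⟩ := Multiset.mem_map.1 hk
  exact Nat.pos_of_ne_zero (Finsupp.mem_support_iff.1 hi)

theorem aeval_psum_monomial {K : Type*} [CommRing K] (μ : ℕ+ →₀ ℕ) (c : K) :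
    MvPolynomial.aeval (psum K) (MvPolynomial.monomial μ c) =
      c • pProd K ((Finsupp.toMultiset μ).map (↑)) := by
  rw [MvPolynomial.aeval_monomial, Algebra.smul_def, pProd, Multiset.map_map, Finsupp.toMultiset_map,
    Finsupp.prod_toMultiset, Finsupp.prod_mapDomain_index (by simp) (by simp [pow_add])]
  rfl

theorem aeval_psum_injective (K : Type*) [Field K] [CharZero K] :
    Function.Injective (MvPolynomial.aeval (psum K) : MvPolynomial ℕ+ K →ₐ[K] SymFn K) := by
  classical
  rw [injective_iff_map_eq_zero]
  intro F hF
  by_contra hne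
  obtain ⟨μ, hμ, hmax⟩ := F.support.exists_max_image (fun μ => (Finsupp.toMultiset μ).card)
    (MvPolynomial.support_nonempty.2 hne)
  have hpos : ∀ ν : ℕ+ →₀ ℕ, ∀ k ∈ (Finsupp.toMultiset ν).map ((↑) : ℕ+ → ℕ), 0 < k := by
    intro ν k hk
    obtain ⟨j, -, rfl⟩ := Multiset.mem_map.1 hk
    exact j.pos
  obtain ⟨d, hd⟩ := exists_parts_eq _ (hpos μ)
  have hsum : MvPolynomial.aeval (psum K) F = ∑ ν ∈ F.support,
      F.coeff ν • pProd K ((Finsupp.toMultiset ν).map (↑)) := by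
    conv_lhs => rw [F.as_sum]
    rw [map_sum]
    exact Finset.sum_congr rfl fun ν _ => aeval_psum_monomial ν _
  have h0 : MvPowerSeries.coeff d ((MvPolynomial.aeval (psum K) F : SymFn K) : MvPowerSeries ℕ K) =
      0 := by rw [hF]; simp
  rw [hsum, AddSubmonoidClass.coe_finsetSum, map_sum, Finset.sum_eq_single μ] at h0
  · rw [Subalgebra.coe_smul, map_smul, coeff_pProd, smul_eq_mul, mul_eq_zero] at h0
    rcases h0 with h0 | h0
    · exact MvPolynomial.mem_support_iff.1 hμ h0
    · exact (coeff_prod_psum _ (hpos μ) d).2 hd (by exact_mod_cast h0)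
  · intro ν hν hνμ
    rw [Subalgebra.coe_smul, map_smul, coeff_pProd]
    by_contra hc
    have hc' : MvPowerSeries.coeff d
        (((Finsupp.toMultiset ν).map ((↑) : ℕ+ → ℕ)).map (psumSeries ℕ)).prod ≠ 0 := by
      intro h; rw [h] at hc; simp at hc
    obtain ⟨-, h2, h3⟩ := (coeff_prod_psum _ (hpos ν) d).1 hc'
    have h4 := hmax ν hν
    have h5 := card_parts d
    rw [hd, Multiset.card_map] at h5
    rw [Multiset.card_map] at h2 h3
    have h6 := h3 (by omega)
    rw [hd] at h6
    have h7 := Multiset.map_injective PNat.coe_injective h6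
    exact hνμ (Multiset.toFinsupp.symm.injective h7.symm)
  · intro h; exact absurd hμ h

theorem pProd_mem_range {K : Type*} [CommRing K] (s : Multiset ℕ) (hs : ∀ k ∈ s, 0 < k) :
    pProd K s ∈ (MvPolynomial.aeval (psum K) : MvPolynomial ℕ+ K →ₐ[K] SymFn K).range := by
  refine Subalgebra.multiset_prod_mem _ fun x hx => ?_
  obtain ⟨k, hk, rfl⟩ := Multiset.mem_map.1 hx
  exact ⟨MvPolynomial.X ⟨k, hs k hk⟩, MvPolynomial.aeval_X _ _⟩

theorem mem_range_of_length (K : Type*) [Field K] [CharZero K] (N L : ℕ) : ∀ f : SymFn K,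
    (∀ d : ℕ →₀ ℕ, N < d.degree → MvPowerSeries.coeff d (f : MvPowerSeries ℕ K) = 0) →
    (∀ d : ℕ →₀ ℕ, L < d.support.card → MvPowerSeries.coeff d (f : MvPowerSeries ℕ K) = 0) →
    f ∈ (MvPolynomial.aeval (psum K) : MvPolynomial ℕ+ K →ₐ[K] SymFn K).range := by
  classical
  induction L with
  | zero =>
    intro f _ hL
    have : f = algebraMap K _ (MvPowerSeries.coeff 0 (f : MvPowerSeries ℕ K)) := by
      ext d
      change _ = MvPowerSeries.coeff d (algebraMap K (MvPowerSeries ℕ K) _)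
      rw [MvPowerSeries.algebraMap_apply, Algebra.algebraMap_self, RingHom.id_apply,
        MvPowerSeries.coeff_C]
      split_ifs with hd
      · rw [hd]
      · refine hL d (Finset.card_pos.2 ?_)
        exact Finsupp.support_nonempty_iff.2 hd
    rw [this]
    exact Subalgebra.algebraMap_mem _ _
  | succ L ih =>
    intro f hN hL
    have hex : ∀ s : Multiset ℕ, ∃ d : ℕ →₀ ℕ, (∀ k ∈ s, 0 < k) → parts d = s := by
      intro s
      by_cases hs : ∀ k ∈ s, 0 < k
      · obtain ⟨d, hd⟩ := exists_parts_eq s hs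
        exact ⟨d, fun _ => hd⟩
      · exact ⟨0, fun h => absurd h hs⟩
    choose D hD using hex
    let c : Multiset ℕ → K := fun s => MvPowerSeries.coeff (D s) (f : MvPowerSeries ℕ K) /
      MvPowerSeries.coeff (D s) (pProd K s : MvPowerSeries ℕ K)
    let T : Finset (Multiset ℕ) := (Finset.range (N + 1)).biUnion fun n =>
      (Finset.univ : Finset (Nat.Partition n)).image Nat.Partition.parts
    have memT : ∀ s, s ∈ T ↔ (∀ k ∈ s, 0 < k) ∧ s.sum ≤ N := by
      intro s
      simp only [T, Finset.mem_biUnion, Finset.mem_range, Finset.mem_image, Finset.mem_univ,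
        true_and]
      constructor
      · rintro ⟨n, hn, π, rfl⟩
        exact ⟨fun k hk => π.parts_pos hk, by rw [π.parts_sum]; omega⟩
      · rintro ⟨h1, h2⟩
        exact ⟨s.sum, by omega, ⟨s, fun {i} hi => h1 i hi, rfl⟩, rfl⟩
    let q : SymFn K := ∑ s ∈ T.filter (fun s => s.card = L + 1), c s • pProd K s
    have hq : q ∈ (MvPolynomial.aeval (psum K) : MvPolynomial ℕ+ K →ₐ[K] SymFn K).range := by
      refine Subalgebra.sum_mem _ fun s hs => Subalgebra.smul_mem _ (pProd_mem_range s ?_) _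
      exact ((memT s).1 (Finset.mem_filter.1 hs).1).1
    have hcoeff : ∀ d : ℕ →₀ ℕ, MvPowerSeries.coeff d (q : MvPowerSeries ℕ K) =
        ∑ s ∈ T.filter (fun s => s.card = L + 1),
          c s * MvPowerSeries.coeff d (pProd K s : MvPowerSeries ℕ K) := by
      intro d
      simp only [q]
      rw [AddSubmonoidClass.coe_finsetSum, map_sum]
      rfl
    have hnz : ∀ s ∈ T, ∀ d : ℕ →₀ ℕ, MvPowerSeries.coeff d (pProd K s : MvPowerSeries ℕ K) ≠ 0 →
        d.degree = s.sum ∧ d.support.card ≤ s.card ∧ (d.support.card = s.card → parts d = s) := by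
      intro s hs d hd
      refine (coeff_prod_psum s ((memT s).1 hs).1 d).1 ?_
      intro h
      rw [coeff_pProd, h] at hd
      simp at hd
    have hsub : ∀ d : ℕ →₀ ℕ, MvPowerSeries.coeff d ((f - q : SymFn K) : MvPowerSeries ℕ K) =
        MvPowerSeries.coeff d (f : MvPowerSeries ℕ K) -
          MvPowerSeries.coeff d (q : MvPowerSeries ℕ K) := fun d => by
      rw [Subalgebra.coe_sub, map_sub]
    have hqN : ∀ d : ℕ →₀ ℕ, N < d.degree → MvPowerSeries.coeff d (q : MvPowerSeries ℕ K) = 0 := by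
      intro d hd
      rw [hcoeff]
      refine Finset.sum_eq_zero fun s hs => ?_
      have hsT := (Finset.mem_filter.1 hs).1
      by_contra hc
      have h1 := (hnz s hsT d (right_ne_zero_of_mul hc)).1
      have h2 := ((memT s).1 hsT).2
      omega
    have hfq := ih (f - q) (fun d hd => by rw [hsub, hN d hd, hqN d hd, sub_zero]) (by
      intro d hd
      rw [hsub]
      by_cases hdN : N < d.degree
      · rw [hN d hdN, hqN d hdN, sub_zero]
      rcases Nat.lt_or_ge (L + 1) d.support.card with hlt | hge
      · rw [hL d hlt, hcoeff, Finset.sum_eq_zero, sub_zero]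
        intro s hs
        by_contra hc
        have h1 := (hnz s (Finset.mem_filter.1 hs).1 d (right_ne_zero_of_mul hc)).2.1
        have h2 := (Finset.mem_filter.1 hs).2
        omega
      · have hcard : d.support.card = L + 1 := by omega
        have hpd : ∀ k ∈ parts d, 0 < k := fun k hk => pos_of_mem_parts hk
        have hdT : parts d ∈ T := (memT _).2 ⟨hpd, by rw [sum_parts]; omega⟩
        rw [hcoeff, Finset.sum_eq_single (parts d)]
        · obtain ⟨σ, hσ⟩ := exists_perm_of_parts_eq (hD _ hpd)
          have e1 := coeff_equivMapDomain f σ (D (parts d))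
          have e2 := coeff_equivMapDomain (pProd K (parts d)) σ (D (parts d))
          rw [hσ] at e1 e2
          have hne : MvPowerSeries.coeff d (pProd K (parts d) : MvPowerSeries ℕ K) ≠ 0 := by
            rw [coeff_pProd]
            exact_mod_cast (coeff_prod_psum _ hpd d).2 rfl
          simp only [c]
          rw [← e1, ← e2, div_mul_cancel₀ _ hne, sub_self]
        · intro s hs hne
          by_contra hc
          have h1 := (hnz s (Finset.mem_filter.1 hs).1 d (right_ne_zero_of_mul hc)).2.2
          have h2 := (Finset.mem_filter.1 hs).2
          exact hne (h1 (by omega)).symm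
        · intro h
          exact absurd (Finset.mem_filter.2 ⟨hdT, by rw [card_parts, hcard]⟩) h)
    have := Subalgebra.add_mem _ hfq hq
    rwa [sub_add_cancel] at this

theorem aeval_psum_surjective (K : Type*) [Field K] [CharZero K] :
    Function.Surjective (MvPolynomial.aeval (psum K) : MvPolynomial ℕ+ K →ₐ[K] SymFn K) := by
  intro f
  obtain ⟨N, hN⟩ := f.2.1
  refine mem_range_of_length K N N f hN fun d hd => hN d (lt_of_lt_of_le hd ?_)
  rw [Finsupp.degree_apply, Finset.card_eq_sum_ones]
  exact Finset.sum_le_sum fun i hi => Nat.one_le_iff_ne_zero.2 (Finsupp.mem_support_iff.1 hi)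

/-- The power sums are free polynomial generators of the symmetric functions: the isomorphism
`K[p_1, p_2, …] ≃ SymFn K`, whose inverse is the expansion in power sums. -/
noncomputable def powerSumEquiv (K : Type*) [Field K] [CharZero K] :
    MvPolynomial ℕ+ K ≃ₐ[K] SymFn K :=
  AlgEquiv.ofBijective (MvPolynomial.aeval (psum K))
    ⟨aeval_psum_injective K, aeval_psum_surjective K⟩

/-! ### Plethysm -/

/-- Plethystic substitution `P ↦ P[E]`: expand `P` in power sums and replace each `p_k` by
`p_k[E]`. The expression `E` enters through the sequence `k ↦ p_k[E]`. -/
noncomputable def pleth {K : Type*} [Field K] [CharZero K] {A : Type*} [CommRing A] [Algebra K A]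
    (E : ℕ+ → A) : SymFn K →ₐ[K] A :=
  (MvPolynomial.aeval E).comp (powerSumEquiv K).symm.toAlgHom

/-- The involution `ω`, `p_k ↦ (-1)^(k-1) p_k`. -/
noncomputable def omega {K : Type*} [Field K] [CharZero K] : SymFn K →ₐ[K] SymFn K :=
  pleth fun k => (-1) ^ ((k : ℕ) - 1) * psum K k

/-! ### The scalar product and the operators dual to multiplication -/

/-- `z_μ = ∏ k ^ {n_k} n_k!` for the partition `μ` with `n_k = μ k` parts equal to `k`. -/
noncomputable def zee (K : Type*) [Field K] (μ : ℕ+ →₀ ℕ) : K :=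
  μ.prod fun k n => ((k : ℕ) : K) ^ n * (n.factorial : K)

/-- The standard scalar product, `⟨p_μ, p_ν⟩ = z_μ δ_{μν}`. -/
noncomputable def scalar {K : Type*} [Field K] [CharZero K] (P Q : SymFn K) : K :=
  ∑ μ ∈ ((powerSumEquiv K).symm P).support,
    zee K μ * ((powerSumEquiv K).symm P).coeff μ * ((powerSumEquiv K).symm Q).coeff μ

/-- The operator `f^⊥` dual to multiplication by `f`, in terms of power sums:
`p_ν^⊥ p_μ = (z_μ / z_{μ-ν}) p_{μ-ν}` if `ν` is contained in `μ`, and `0` otherwise.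
The duality is `scalar_skew`. -/
noncomputable def skew {K : Type*} [Field K] [CharZero K] (f g : SymFn K) : SymFn K :=
  powerSumEquiv K
    (∑ ν ∈ ((powerSumEquiv K).symm f).support, ∑ μ ∈ ((powerSumEquiv K).symm g).support,
      if ν ≤ μ then MvPolynomial.monomial (μ - ν)
        (((powerSumEquiv K).symm f).coeff ν * ((powerSumEquiv K).symm g).coeff μ *
          (zee K μ / zee K (μ - ν))) else 0)

theorem zee_ne_zero (K : Type*) [Field K] [CharZero K] (μ : ℕ+ →₀ ℕ) : zee K μ ≠ 0 := by
  unfold zee Finsupp.prod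
  refine Finset.prod_ne_zero_iff.2 fun k _ => mul_ne_zero (pow_ne_zero _ ?_) ?_
  · exact_mod_cast k.ne_zero
  · exact_mod_cast Nat.factorial_ne_zero _

theorem scalar_eq_of_subset {K : Type*} [Field K] [CharZero K] (P Q : SymFn K)
    (T : Finset (ℕ+ →₀ ℕ)) (hT : ((powerSumEquiv K).symm P).support ⊆ T) :
    scalar P Q = ∑ μ ∈ T, zee K μ * ((powerSumEquiv K).symm P).coeff μ *
      ((powerSumEquiv K).symm Q).coeff μ := by
  refine Finset.sum_subset hT fun μ _ hμ => ?_
  rw [MvPolynomial.notMem_support_iff.1 hμ]; simp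

theorem scalar_comm {K : Type*} [Field K] [CharZero K] (P Q : SymFn K) :
    scalar P Q = scalar Q P := by
  classical
  rw [scalar_eq_of_subset P Q _ Finset.subset_union_left,
    scalar_eq_of_subset Q P _ Finset.subset_union_right]
  exact Finset.sum_congr rfl fun _ _ => by ring

/-- `f^⊥` is the adjoint of multiplication by `f`. -/
theorem scalar_skew {K : Type*} [Field K] [CharZero K] (f g a : SymFn K) :
    scalar (skew f g) a = scalar g (f * a) := by
  classical
  set F := (powerSumEquiv K).symm f with hF
  set G := (powerSumEquiv K).symm g with hG
  set A := (powerSumEquiv K).symm a with hA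
  have hS : (powerSumEquiv K).symm (skew f g) = ∑ ν ∈ F.support, ∑ μ ∈ G.support,
      if ν ≤ μ then MvPolynomial.monomial (μ - ν)
        (F.coeff ν * G.coeff μ * (zee K μ / zee K (μ - ν))) else 0 := by
    rw [skew, AlgEquiv.symm_apply_apply]
  have h1 : scalar (skew f g) a = ∑ ν ∈ F.support, ∑ μ ∈ G.support,
      if ν ≤ μ then F.coeff ν * G.coeff μ * zee K μ * A.coeff (μ - ν) else 0 := by
    rw [scalar_comm, scalar, hS]
    rw [← hA]
    simp only [MvPolynomial.coeff_sum, Finset.mul_sum]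
    rw [Finset.sum_comm]
    refine Finset.sum_congr rfl fun ν _ => ?_
    rw [Finset.sum_comm]
    refine Finset.sum_congr rfl fun μ _ => ?_
    split_ifs with hle
    · simp only [MvPolynomial.coeff_monomial]
      rw [Finset.sum_eq_single (μ - ν)]
      · rw [if_pos rfl]
        have := zee_ne_zero K (μ - ν)
        field_simp
      · intro ρ _ hρ
        rw [if_neg (Ne.symm hρ), mul_zero]
      · intro hρ
        rw [MvPolynomial.notMem_support_iff.1 hρ]; simp
    · simp
  have h2 : ∀ μ, (F * A).coeff μ = ∑ ν ∈ F.support,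
      if ν ≤ μ then F.coeff ν * A.coeff (μ - ν) else 0 := by
    intro μ
    conv_lhs => rw [F.as_sum, Finset.sum_mul, MvPolynomial.coeff_sum]
    exact Finset.sum_congr rfl fun ν _ => by rw [MvPolynomial.coeff_monomial_mul']
  rw [h1, scalar, map_mul, ← hF, ← hA, ← hG, Finset.sum_comm]
  refine Finset.sum_congr rfl fun μ _ => ?_
  rw [h2, Finset.mul_sum]
  refine Finset.sum_congr rfl fun ν _ => ?_
  split_ifs
  · ring
  · ring

/-! ### Schur functions -/

/-- `h_n` for an integer `n`, which is `0` for negative `n`. -/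
noncomputable def hInt (K : Type*) [CommRing K] (n : ℤ) : SymFn K :=
  if 0 ≤ n then hsymm K n.toNat else 0

/-- The Schur function `s_μ = det (h_{μ_i - i + j})`. -/
noncomputable def schur (K : Type*) [CommRing K] (μ : YoungDiagram) : SymFn K :=
  Matrix.det (Matrix.of fun i j : Fin (μ.colLen 0) =>
    hInt K ((μ.rowLen i : ℤ) - (i : ℤ) + (j : ℤ)))

/-! ### Formal series in `z`-monomials

The formal series in variables `z` (with finitely many negative powers) and coefficients in
`SymFn K` are Hahn series whose exponents lie in an ordered group `Γ`: `ℤ` for a single variable,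
and `Fin m → ℤ` with the componentwise order for `z_1, …, z_m`. -/

/-- The series `∑ n, a_n z^n`, where `z` is the monomial with exponent `g > 0`. -/
noncomputable def powerSeriesAt {Γ : Type*} [AddCommGroup Γ] [PartialOrder Γ]
    [IsOrderedAddMonoid Γ] {R : Type*} [CommRing R] (g : Γ) (hg : 0 < g) (a : ℕ → R) :
    HahnSeries Γ R :=
  HahnSeries.embDomain
    (⟨⟨fun n : ℕ => n • g, (nsmul_left_strictMono hg).injective⟩,
      (nsmul_left_strictMono hg).le_iff_le⟩ : ℕ ↪o Γ)
    (HahnSeries.toPowerSeries.symm (PowerSeries.mk a))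

/-- `Ω[z X] = ∑ n, h_n[X] z^n`. -/
noncomputable def Omega (K : Type*) [CommRing K] {Γ : Type*} [AddCommGroup Γ]
    [PartialOrder Γ] [IsOrderedAddMonoid Γ] (g : Γ) (hg : 0 < g) : HahnSeries Γ (SymFn K) :=
  powerSeriesAt g hg (hsymm K)

/-- `Ω[-z X] = ∑ n, h_n[-X] z^n`, where `p_k[-X] = -p_k`. -/
noncomputable def OmegaNeg (K : Type*) [Field K] [CharZero K] {Γ : Type*} [AddCommGroup Γ]
    [PartialOrder Γ] [IsOrderedAddMonoid Γ] (g : Γ) (hg : 0 < g) : HahnSeries Γ (SymFn K) :=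
  powerSeriesAt g hg fun n => pleth (fun k => -psum K k) (hsymm K n)

/-! ### The operators -/

/-- The operator `S_m`: the coefficient of `z^m` in `P[X - 1/z] Ω[z X]`, where
`p_k[X - 1/z] = p_k - z^(-k)`. -/
noncomputable def S {K : Type*} [Field K] [CharZero K] (m : ℤ) (P : SymFn K) : SymFn K :=
  (pleth (fun k : ℕ+ => HahnSeries.C (psum K k) - HahnSeries.single (-((k : ℕ) : ℤ)) 1) P *
    Omega K (1 : ℤ) one_pos).coeff m

/-- The operator `ω S_m ω`. -/
noncomputable def STilde {K : Type*} [Field K] [CharZero K] (m : ℤ) (P : SymFn K) : SymFn K :=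
  omega (S m (omega P))

/-- `λ^rc`: the diagram of `λ` with its first row and first column removed. -/
def rc (μ : YoungDiagram) : YoungDiagram where
  cells := μ.cells.filter fun c => (c.1 + 1, c.2 + 1) ∈ μ
  isLowerSet := by
    intro a b hba ha
    simp only [Finset.coe_filter, Set.mem_ofPred_eq, YoungDiagram.mem_cells] at ha ⊢
    exact ⟨μ.isLowerSet hba ha.1,
      μ.isLowerSet (Prod.mk_le_mk.2 ⟨Nat.succ_le_succ hba.1, Nat.succ_le_succ hba.2⟩) ha.2⟩

/-- A ribbon `R = λ / λ^rc` of size `m`, recorded by the nonempty partition `λ`, for which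
`λ_1 + ℓ(λ) - 1 = m`. -/
def Ribbon (m : ℕ) : Type :=
  {μ : YoungDiagram // μ ≠ ⊥ ∧ μ.rowLen 0 + μ.colLen 0 - 1 = m}

instance (m : ℕ) : Finite (Ribbon m) := by
  let B := Finset.range (m + 1) ×ˢ Finset.range (m + 1)
  refine Finite.of_injective
    (fun R : Ribbon m => (⟨R.1.cells, ?_⟩ : {T : Finset (ℕ × ℕ) // T ∈ B.powerset})) ?_
  · refine Finset.mem_powerset.2 fun c hc => ?_
    have h0 := R.2.2
    have hc : (c.1, c.2) ∈ R.1 := hc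
    have h1 := YoungDiagram.mem_iff_lt_rowLen.1 hc
    have h2 := YoungDiagram.mem_iff_lt_colLen.1 hc
    have h3 := R.1.rowLen_anti 0 c.1 (Nat.zero_le _)
    have h4 := R.1.colLen_anti 0 c.2 (Nat.zero_le _)
    rw [Finset.mem_product, Finset.mem_range, Finset.mem_range]
    omega
  · intro R R' h
    exact Subtype.ext (YoungDiagram.ext (congrArg Subtype.val h))

noncomputable instance (m : ℕ) : Fintype (Ribbon m) := Fintype.ofFinite _

/-- The cells of the skew diagram `λ / λ^rc`. The first coordinate of a cell is its row and the
second its column; rows are drawn from the bottom (row `0`) up. -/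
def Ribbon.cells {m : ℕ} (R : Ribbon m) : Finset (ℕ × ℕ) := R.1.cells \ (rc R.1).cells

/-- The label of a cell when the cells of a ribbon are labeled with `1, …, m` from left to right
and, within a column, from top to bottom. -/
def Ribbon.label {m : ℕ} (R : Ribbon m) (c : ℕ × ℕ) : ℕ :=
  (R.cells.filter fun c' => c'.2 < c.2 ∨ (c'.2 = c.2 ∧ c.1 ≤ c'.1)).card

/-- The descent set: the labels of those cells whose successor is the cell directly below. -/
def Ribbon.descents {m : ℕ} (R : Ribbon m) : Finset ℕ :=
  (R.cells.filter fun c => ∃ c' ∈ R.cells, R.label c' = R.label c + 1 ∧ c'.1 < c.1).image R.label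

/-- The major index. -/
def Ribbon.maj {m : ℕ} (R : Ribbon m) : ℕ := ∑ i ∈ R.descents, i

/-- `comaj(R) = binom(|R|, 2) - maj(R)`. -/
def Ribbon.comaj {m : ℕ} (R : Ribbon m) : ℕ := m.choose 2 - R.maj

/-- The ribbon operator `S^R = s_{λ^rc}^⊥ S̃_{λ'_1} S̃_{λ'_2} ⋯`; the entries of
`λ.transpose.rowLens` are the column lengths `λ'_1, λ'_2, …`. -/
noncomputable def ribbonOp {K : Type*} [Field K] [CharZero K] {m : ℕ} (R : Ribbon m)
    (P : SymFn K) : SymFn K :=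
  skew (schur K (rc R.1)) (R.1.transpose.rowLens.foldr (fun c Q => STilde (c : ℤ) Q) P)

/-- The operator `H^t_{1^m} = ∑_R t^{comaj(R)} S^R`, summed over the ribbons of size `m`. -/
noncomputable def columnOp {K : Type*} [Field K] [CharZero K] (t : K) (m : ℕ)
    (P : SymFn K) : SymFn K :=
  ∑ R : Ribbon m, t ^ R.comaj • ribbonOp R P

/-- The exponent of the monomial `z_i`. -/
def zExp {m : ℕ} (i : Fin m) : Fin m → ℤ := Pi.single i 1

theorem zExp_pos {m : ℕ} (i : Fin m) : 0 < zExp i := Pi.single_pos.2 one_pos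

/-- `P[X + Z^*]`, where `p_k[X + Z^*] = p_k + ∑ i, z_i^(-k)`. -/
noncomputable def plethAddZStar {K : Type*} [Field K] [CharZero K] (m : ℕ) :
    SymFn K →ₐ[K] HahnSeries (Fin m → ℤ) (SymFn K) :=
  pleth fun k => HahnSeries.C (psum K k) +
    ∑ i : Fin m, HahnSeries.single (-((k : ℕ) • zExp i)) 1

end RibbonOperators

namespace RibbonOperators

/-! ### Symmetric functions as polynomials in the power sums -/

/-! Number the variables z_0, …, z_{m-1}. Expanding ∏ (1 - t^i Ω[-z_i X]) gives a sum over subsets A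
of the variables: A carries the weight (-1)^|A| t^(∑_{i∈A} i) and the coefficient of z_0 ⋯ z_{m-1}
in P[X+Z^*] ∏_{i∈A} Ω[-z_i X] ∏_{i<j} (1 - z_j/z_i). If 0 ∉ A, no factor contains a positive power
of z_0 and the coefficient vanishes (`subsetCoeff_eq_zero`). The subsets containing 0 correspond to
the ribbons of size m: read a ribbon cell by cell and let A collect the zero-based positions at
which a new column begins. The other positions are those reached by a step down; they are exactly
the descents, so ∑_{i∈A} i is comaj (`Ribbon.comaj_eq`).

It remains to see that S^R equals (-1)^|A| times the coefficient of A (`ribbonOp_eq`). Both kinds of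
operators in S^R are coefficients of translations: h_n^⊥ P is the coefficient of v^n in P[X+v]
(`skew_hsymm`), and S̃_a P is (-1)^a times the coefficient of z^a in P[X+1/z] Ω[-zX]
(`STilde_natCast`). Since Ω[-z(X+v)] = Ω[-zX](1 - zv), moving the translation by 1/z_i to the right
past Ω[-z_j X] costs a factor 1 - z_j/z_i; this brings any composition into normal order
(`wordOp_eq_coeff`).

Let a_0 < a_1 < ⋯ be the elements of A and b_0 > b_1 > ⋯ the others. Attach the letters b to the h^⊥
of the Jacobi–Trudi expansion of s_{λ^rc} and the letters a to the S̃. Normal ordering yields 1 -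
z_{a_j}/z_{a_i} for i < j and 1 - z_{a_i}/z_{b_r} for all i, r. The signed sum over permutations is
a Vandermonde determinant and supplies the pairs of b's. A mixed pair with a_i < b_r has the wrong
orientation, and 1 - z_b/z_a = -(z_b/z_a)(1 - z_a/z_b) repairs it. These monomials turn the exponent
1 of z_{a_i} into 1 + #{r : a_i < b_r}, a column length of λ, and that of z_{b_r} into 1 - #{i : a_i
< b_r}, minus a row length of λ^rc. Their signs cancel against those of the S̃, up to (-1)^|A|
(`Shuffle.skew_det_foldr_STilde`). -/

/-- The ring structure of `SymFn K` through its commutative ring structure. -/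
@[reducible] noncomputable def symFnRing {K : Type*} [CommRing K] : Ring (SymFn K) :=
  (SymFn K).toCommRing.toRing

/-- The negation of `SymFn K` through its commutative ring structure. -/
@[reducible] noncomputable def symFnNeg {K : Type*} [CommRing K] : Neg (SymFn K) :=
  (SymFn K).toCommRing.toRing.toNeg

/-- The subtraction of `SymFn K` through its commutative ring structure. -/
@[reducible] noncomputable def symFnSub {K : Type*} [CommRing K] : Sub (SymFn K) :=
  (SymFn K).toCommRing.toRing.toSub

/-! ### Newton's identities -/

section Coefficients

variable {K : Type*} [CommRing K]

theorem coeff_hsymm (n : ℕ) (d : ℕ →₀ ℕ) :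
    MvPowerSeries.coeff d (hsymm K n : MvPowerSeries ℕ K) = if d.degree = n then 1 else 0 := rfl

/-- A monomial x^d of the right degree arises once from each variable x_i whose k-th power divides
it. -/
theorem coeff_psumSeries_mul_hsymm (k n : ℕ) (hk : 0 < k) (d : ℕ →₀ ℕ) :
    MvPowerSeries.coeff d (psumSeries K k * (hsymm K n : MvPowerSeries ℕ K)) =
      if d.degree = k + n then ((d.support.filter fun i => k ≤ d i).card : K) else 0 := by
  classical
  rw [MvPowerSeries.coeff_mul]
  simp only [coeff_psumSeries, coeff_hsymm, ← ite_and, mul_ite, mul_one, mul_zero]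
  rw [Finset.sum_ite, Finset.sum_const_zero, add_zero, Finset.sum_const, nsmul_eq_mul, mul_one]
  split_ifs with hd
  · congr 1
    symm
    refine Finset.card_bij (fun i _ => (Finsupp.single i k, d - Finsupp.single i k)) ?_ ?_ ?_
    · intro i hi
      have hle : Finsupp.single i k ≤ d := by
        rw [Finsupp.single_le_iff]; exact (Finset.mem_filter.1 hi).2
      have he : Finsupp.single i k + (d - Finsupp.single i k) = d := add_tsub_cancel_of_le hle
      refine Finset.mem_filter.2 ⟨Finset.HasAntidiagonal.mem_antidiagonal.2 he, ?_, ⟨i, rfl⟩⟩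
      have h1 := congrArg Finsupp.degree he
      rw [map_add, Finsupp.degree_single] at h1
      change (d - Finsupp.single i k).degree = n
      omega
    · intro i _ j _ hij
      exact (Finsupp.single_left_injective hk.ne') (Prod.ext_iff.1 hij).1
    · rintro ⟨a, b⟩ hab
      obtain ⟨h1, -, ⟨i, hi⟩⟩ := Finset.mem_filter.1 hab
      rw [Finset.HasAntidiagonal.mem_antidiagonal] at h1
      simp only at h1 hi
      subst hi
      have h2 : k ≤ d i := by rw [← h1]; simp
      refine ⟨i, Finset.mem_filter.2 ⟨by rw [Finsupp.mem_support_iff]; omega, h2⟩, ?_⟩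
      rw [← h1, add_tsub_cancel_left]
  · refine (congrArg Nat.cast (Finset.card_eq_zero.2
      (Finset.filter_eq_empty_iff.2 ?_))).trans Nat.cast_zero
    rintro ⟨a, b⟩ hab ⟨h1, ⟨i, h2⟩⟩
    rw [Finset.HasAntidiagonal.mem_antidiagonal] at hab
    simp only at h1 h2 hab
    apply hd
    rw [← hab, map_add, h1, h2, Finsupp.degree_single]

theorem hsymm_zero : hsymm K 0 = 1 := by
  classical
  ext d
  change MvPowerSeries.coeff d (hsymm K 0 : MvPowerSeries ℕ K) =
    MvPowerSeries.coeff d (1 : MvPowerSeries ℕ K)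
  rw [coeff_hsymm, MvPowerSeries.coeff_one]
  simp [Finsupp.degree_eq_zero_iff]

/-- At a monomial x^d of degree n + 1 the right side counts the pairs (i, k) with 1 ≤ k ≤ d_i, of
which there are n + 1. -/
theorem newton_hsymm (n : ℕ) : ((n : K) + 1) • hsymm K (n + 1) =
    ∑ k ∈ Finset.range (n + 1), psum K k.succPNat * hsymm K (n - k) := by
  classical
  ext d
  change MvPowerSeries.coeff d ((((n : K) + 1) • hsymm K (n + 1) : SymFn K) : MvPowerSeries ℕ K) =
    MvPowerSeries.coeff d
      ((∑ k ∈ Finset.range (n + 1), psum K k.succPNat * hsymm K (n - k) : SymFn K) :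
        MvPowerSeries ℕ K)
  rw [AddSubmonoidClass.coe_finsetSum, map_sum]
  have h1 : ∀ k ∈ Finset.range (n + 1), MvPowerSeries.coeff d
      ((psum K k.succPNat * hsymm K (n - k) : SymFn K) : MvPowerSeries ℕ K) =
        if d.degree = n + 1 then ((d.support.filter fun i => k + 1 ≤ d i).card : K) else 0 := by
    intro k hk
    rw [Finset.mem_range] at hk
    have := coeff_psumSeries_mul_hsymm (K := K) (k + 1) (n - k) (Nat.succ_pos k) d
    rw [show k + 1 + (n - k) = n + 1 by omega] at this
    rw [← this]
    rfl
  rw [Finset.sum_congr rfl h1, Subalgebra.coe_smul, map_smul, coeff_hsymm]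
  split_ifs with hd
  · rw [smul_eq_mul, mul_one, ← Nat.cast_sum]
    have h2 : ∑ k ∈ Finset.range (n + 1), (d.support.filter fun i => k + 1 ≤ d i).card = n + 1 := by
      simp only [Finset.card_filter]
      rw [Finset.sum_comm, ← hd]
      conv_rhs => rw [Finsupp.degree_apply]
      refine Finset.sum_congr rfl fun i hi => ?_
      have hle : d i ≤ d.degree := Finsupp.le_degree i d
      rw [← Finset.card_filter]
      have : (Finset.range d.degree).filter (fun k => k + 1 ≤ d i) = Finset.range (d i) := by
        ext k; simp; omega
      rw [this, Finset.card_range]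
    rw [h2]; push_cast; ring
  · simp

end Coefficients

section SymmetricFunctions

attribute [local instance] symFnRing symFnNeg symFnSub

variable {K : Type*} [Field K] [CharZero K]

theorem powerSumEquiv_X (k : ℕ+) : powerSumEquiv K (MvPolynomial.X k) = psum K k :=
  MvPolynomial.aeval_X _ _

theorem powerSumEquiv_symm_psum (k : ℕ+) :
    (powerSumEquiv K).symm (psum K k) = MvPolynomial.X k := by
  rw [← powerSumEquiv_X, AlgEquiv.symm_apply_apply]

theorem pleth_psum {A : Type*} [CommRing A] [Algebra K A] (E : ℕ+ → A) (k : ℕ+) :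
    pleth E (psum K k) = E k := by
  change MvPolynomial.aeval E ((powerSumEquiv K).symm (psum K k)) = E k
  rw [powerSumEquiv_symm_psum, MvPolynomial.aeval_X]

/-- Induction over the power sums. -/
theorem symFn_induction {p : SymFn K → Prop} (hC : ∀ r : K, p (algebraMap K _ r))
    (hadd : ∀ f g, p f → p g → p (f + g)) (hmul : ∀ f k, p f → p (f * psum K k))
    (f : SymFn K) : p f := by
  obtain ⟨F, rfl⟩ := (powerSumEquiv K).surjective f
  induction F using MvPolynomial.induction_on with
  | C r => rw [← MvPolynomial.algebraMap_eq, AlgEquiv.commutes]; exact hC r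
  | add F G hF hG => rw [map_add]; exact hadd _ _ hF hG
  | mul_X F k hF => rw [map_mul, powerSumEquiv_X]; exact hmul _ _ hF

theorem symFn_ringHom_ext {A : Type*} [CommRing A] {f g : SymFn K →+* A}
    (hC : ∀ r : K, f (algebraMap K _ r) = g (algebraMap K _ r))
    (hp : ∀ k, f (psum K k) = g (psum K k)) : f = g := by
  ext P
  induction P using symFn_induction with
  | hC r => exact hC r
  | hadd P Q hP hQ => rw [map_add, map_add, hP, hQ]
  | hmul P k hP => rw [map_mul, map_mul, hP, hp]

/-- `h_n[-X]`. -/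
noncomputable def hNeg (K : Type*) [Field K] [CharZero K] (n : ℕ) : SymFn K :=
  pleth (fun k => -psum K k) (hsymm K n)

theorem hNeg_zero : hNeg K 0 = 1 := by rw [hNeg, hsymm_zero, map_one]

theorem newton_hNeg (n : ℕ) : ((n : K) + 1) • hNeg K (n + 1) =
    -∑ k ∈ Finset.range (n + 1), psum K k.succPNat * hNeg K (n - k) := by
  have := congrArg (pleth (A := SymFn K) fun k => -psum K k) (newton_hsymm (K := K) n)
  rw [map_smul, map_sum] at this
  simp only [map_mul, pleth_psum] at this
  rw [hNeg, this, ← Finset.sum_neg_distrib]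
  exact Finset.sum_congr rfl fun k _ => by rw [neg_mul]; rfl

/-- Characteristic zero lets Newton's recursion determine its solution; the inductions below all
cancel the factor n + 1 in this way. -/
theorem smul_succ_injective (A : Type*) [AddCommGroup A] [Module K A] (n : ℕ) {a b : A}
    (h : ((n : K) + 1) • a = ((n : K) + 1) • b) : a = b :=
  smul_right_injective A (Nat.cast_add_one_ne_zero n : (n : K) + 1 ≠ 0) h

/-- The two sides satisfy the same Newton recursion, because ω(p_k) = (-1)^k · (-p_k). The
elementary functions enter the proof only in the form (-1)^n h_n[-X]. -/
theorem omega_hsymm (n : ℕ) : omega (hsymm K n) = (-1) ^ n * hNeg K n := by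
  induction n using Nat.strong_induction_on with
  | _ n ih =>
    cases n with
    | zero => rw [hsymm_zero, map_one, hNeg_zero, pow_zero, one_mul]
    | succ n =>
      refine smul_succ_injective (K := K) _ n ?_
      rw [← map_smul, newton_hsymm, map_sum, ← mul_smul_comm, newton_hNeg, mul_neg, Finset.mul_sum,
        ← Finset.sum_neg_distrib]
      refine Finset.sum_congr rfl fun k hk => ?_
      rw [Finset.mem_range] at hk
      rw [map_mul, ih (n - k) (by omega)]
      have h1 : omega (psum K k.succPNat) = (-1) ^ k * psum K k.succPNat := by
        rw [omega, pleth_psum]; rfl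
      have h2 : ((-1) ^ (n + 1) : SymFn K) = -((-1) ^ k * (-1) ^ (n - k)) := by
        rw [← pow_add, pow_succ, mul_neg_one, show k + (n - k) = n by omega]
      rw [h1, h2]; ring

/-! ### Translation -/

open Polynomial in
/-- The substitution `P ↦ P[X + v]`, as a polynomial in `v`. -/
noncomputable def translate (K : Type*) [Field K] [CharZero K] :
    SymFn K →ₐ[K] Polynomial (SymFn K) :=
  pleth fun k => C (psum K k) + X ^ (k : ℕ)

theorem translate_psum (k : ℕ+) :
    translate K (psum K k) = Polynomial.C (psum K k) + Polynomial.X ^ (k : ℕ) := pleth_psum _ _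

theorem translate_hNeg_zero : translate K (hNeg K 0) = Polynomial.C (hNeg K 0) := by
  rw [hNeg_zero, map_one, map_one]

-- This is Ω[-z(X+v)] = Ω[-zX](1 - zv) read off at z^(n+1). Newton's recursion replaces manipulation
-- of exponentials; the extra powers of v telescope.
open Polynomial in
theorem translate_hNeg_succ (n : ℕ) :
    translate K (hNeg K (n + 1)) = C (hNeg K (n + 1)) - X * C (hNeg K n) := by
  induction n using Nat.strong_induction_on with
  | _ n ih =>
    refine smul_succ_injective (K := K) _ n ?_
    -- For k < n the index n - k is positive, so the induction hypothesis applies; the last bracket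
    -- is the telescoping difference.
    have e1 : ∀ k ∈ Finset.range n, (C (psum K k.succPNat) + X ^ (k + 1)) *
        translate K (hNeg K (n - k)) = C (psum K k.succPNat * hNeg K (n - k))
          - X * C (psum K k.succPNat * hNeg K (n - 1 - k))
          - (X ^ (k + 2) * C (hNeg K (n - (k + 1))) - X ^ (k + 1) * C (hNeg K (n - k))) := by
      intro k hk
      rw [Finset.mem_range] at hk
      obtain ⟨j, hj⟩ : ∃ j, n - k = j + 1 := ⟨n - k - 1, by omega⟩
      rw [hj, ih j (by omega), show n - 1 - k = j by omega, show n - (k + 1) = j by omega,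
        C_mul, C_mul]
      ring
    rw [← map_smul, newton_hNeg, map_neg, map_sum]
    simp only [map_mul, translate_psum, Nat.succPNat_coe, Nat.succ_eq_add_one]
    rw [Finset.sum_range_succ, Finset.sum_congr rfl e1, Finset.sum_sub_distrib,
      Finset.sum_sub_distrib, Finset.sum_range_sub (fun k => X ^ (k + 1) * C (hNeg K (n - k)))]
    simp only [Nat.sub_self, translate_hNeg_zero, Nat.sub_zero, zero_add, pow_one]
    rw [smul_sub, smul_C, newton_hNeg, ← mul_smul_comm, smul_C]
    -- The recursion one degree lower, with n + 1 split as n plus 1.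
    have h3 : ((n : K) + 1) • hNeg K n = hNeg K n -
        ∑ k ∈ Finset.range n, psum K k.succPNat * hNeg K (n - 1 - k) := by
      cases n with
      | zero => simp
      | succ n =>
        have := newton_hNeg (K := K) n
        rw [add_smul, one_smul]
        push_cast
        rw [this]
        exact neg_add_eq_sub _ _
    rw [h3, Finset.sum_range_succ, ← Finset.mul_sum]
    simp only [C_neg, C_add, C_sub, map_sum, C_mul, Nat.sub_self]
    ring

end SymmetricFunctions

/-! ### Adjoints of multiplication operators -/

section Skew

attribute [local instance] symFnRing symFnNeg symFnSub

variable {K : Type*} [Field K] [CharZero K]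

theorem scalar_add (P Q R : SymFn K) : scalar P (Q + R) = scalar P Q + scalar P R := by
  unfold scalar
  rw [← Finset.sum_add_distrib]
  refine Finset.sum_congr rfl fun μ _ => ?_
  rw [map_add, MvPolynomial.coeff_add, mul_add]

theorem scalar_smul (c : K) (P Q : SymFn K) : scalar P (c • Q) = c * scalar P Q := by
  unfold scalar
  rw [Finset.mul_sum]
  refine Finset.sum_congr rfl fun μ _ => ?_
  rw [map_smul, MvPolynomial.coeff_smul, smul_eq_mul]
  ring

/-- The products of power sums are orthogonal and z_μ ≠ 0, so the form is nondegenerate. The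
algebraic laws of f^⊥ then follow by pairing with an arbitrary function. -/
theorem scalar_right_ext {P Q : SymFn K} (h : ∀ a, scalar a P = scalar a Q) : P = Q := by
  classical
  refine (powerSumEquiv K).symm.injective (MvPolynomial.ext _ _ fun μ => ?_)
  have key : ∀ R : SymFn K, scalar (powerSumEquiv K (MvPolynomial.monomial μ 1)) R =
      zee K μ * ((powerSumEquiv K).symm R).coeff μ := by
    intro R
    rw [scalar, AlgEquiv.symm_apply_apply, MvPolynomial.support_monomial, if_neg one_ne_zero,
      Finset.sum_singleton, MvPolynomial.coeff_monomial, if_pos rfl, mul_one]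
  have := h (powerSumEquiv K (MvPolynomial.monomial μ 1))
  rw [key, key] at this
  exact mul_left_cancel₀ (zee_ne_zero K μ) this

theorem scalar_left_ext {P Q : SymFn K} (h : ∀ a, scalar P a = scalar Q a) : P = Q :=
  scalar_right_ext fun a => by rw [scalar_comm a, scalar_comm a, h]

theorem add_scalar (P Q R : SymFn K) : scalar (P + Q) R = scalar P R + scalar Q R := by
  rw [scalar_comm, scalar_add, scalar_comm R, scalar_comm R]

theorem smul_scalar (c : K) (P Q : SymFn K) : scalar (c • P) Q = c * scalar P Q := by
  rw [scalar_comm, scalar_smul, scalar_comm Q]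

theorem skew_one (P : SymFn K) : skew 1 P = P :=
  scalar_left_ext fun a => by rw [scalar_skew, one_mul]

theorem skew_mul (f g P : SymFn K) : skew (f * g) P = skew f (skew g P) :=
  scalar_left_ext fun a => by
    rw [scalar_skew, scalar_skew, scalar_skew]; congr 1; ring

theorem add_skew (f g P : SymFn K) : skew (f + g) P = skew f P + skew g P :=
  scalar_left_ext fun a => by
    rw [scalar_skew, add_scalar, scalar_skew, scalar_skew, ← scalar_add, add_mul]

theorem smul_skew (c : K) (f P : SymFn K) : skew (c • f) P = c • skew f P :=
  scalar_left_ext fun a => by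
    rw [scalar_skew, smul_scalar, scalar_skew, ← scalar_smul, smul_mul_assoc]

theorem skew_add (f P Q : SymFn K) : skew f (P + Q) = skew f P + skew f Q :=
  scalar_left_ext fun a => by
    rw [scalar_skew, add_scalar, add_scalar, scalar_skew, scalar_skew]

theorem skew_smul (c : K) (f P : SymFn K) : skew f (c • P) = c • skew f P :=
  scalar_left_ext fun a => by
    rw [scalar_skew, smul_scalar, smul_scalar, scalar_skew]

/-- `f ↦ f^⊥` as an algebra homomorphism into the linear operators. -/
noncomputable def skewHom (K : Type*) [Field K] [CharZero K] :
    SymFn K →ₐ[K] Module.End K (SymFn K) :=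
  AlgHom.ofLinearMap
    { toFun := fun f => { toFun := skew f, map_add' := skew_add f,
                          map_smul' := fun c P => skew_smul c f P }
      map_add' := fun f g => LinearMap.ext fun P => add_skew f g P
      map_smul' := fun c f => LinearMap.ext fun P => smul_skew c f P }
    (LinearMap.ext skew_one) (fun f g => LinearMap.ext fun P => skew_mul f g P)

theorem skewHom_apply (f P : SymFn K) : skewHom K f P = skew f P := rfl

/-- The derivation `∂ / ∂p_k`. -/
noncomputable def psumDeriv (k : ℕ+) : SymFn K →ₗ[K] SymFn K :=
  (powerSumEquiv K).toLinearMap ∘ₗ (MvPolynomial.pderiv k).toLinearMap ∘ₗ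
    (powerSumEquiv K).symm.toLinearMap

theorem psumDeriv_apply (k : ℕ+) (P : SymFn K) :
    psumDeriv k P = powerSumEquiv K (MvPolynomial.pderiv k ((powerSumEquiv K).symm P)) := rfl

theorem psumDeriv_algebraMap (k : ℕ+) (r : K) : psumDeriv k (algebraMap K (SymFn K) r) = 0 := by
  rw [psumDeriv_apply, AlgEquiv.commutes, MvPolynomial.algebraMap_eq, MvPolynomial.pderiv_C,
    map_zero]

theorem psumDeriv_mul (k : ℕ+) (P Q : SymFn K) :
    psumDeriv k (P * Q) = P * psumDeriv k Q + Q * psumDeriv k P := by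
  simp only [psumDeriv_apply, map_mul, Derivation.leibniz, map_add, smul_eq_mul,
    AlgEquiv.apply_symm_apply]

theorem psumDeriv_psum (k j : ℕ+) : psumDeriv k (psum K j) = if j = k then 1 else 0 := by
  classical
  rw [psumDeriv_apply, powerSumEquiv_symm_psum, MvPolynomial.pderiv_X, Pi.single_apply]
  split_ifs <;> simp

omit [CharZero K] in
theorem zee_single_add (k : ℕ+) (ν : ℕ+ →₀ ℕ) :
    zee K (Finsupp.single k 1 + ν) = (k : ℕ) * ((ν k + 1 : ℕ) : K) * zee K ν := by
  classical
  have key : ∀ μ : ℕ+ →₀ ℕ, zee K μ = ((k : ℕ) : K) ^ (μ k) * ((μ k).factorial : K) *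
      zee K (μ.erase k) := by
    intro μ
    exact (Finsupp.mul_prod_erase' μ k (fun k n => ((k : ℕ) : K) ^ n * (n.factorial : K))
      (fun _ => by simp)).symm
  have he : (Finsupp.single k 1 + ν).erase k = ν.erase k := by
    ext j
    by_cases hj : j = k
    · subst hj; simp
    · simp [Finsupp.erase_ne hj]
  rw [key, key ν, he, Finsupp.add_apply, Finsupp.single_eq_same, add_comm 1, pow_succ,
    Nat.factorial_succ]
  push_cast
  ring

/-- Adding a part k to ν multiplies z_ν by k(n_k + 1), where n_k is its multiplicity in ν; the
derivative accounts for n_k + 1 and leaves k. -/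
theorem skew_psum (k : ℕ+) (P : SymFn K) : skew (psum K k) P = ((k : ℕ) : K) • psumDeriv k P := by
  classical
  rw [skew, powerSumEquiv_symm_psum, psumDeriv_apply, ← map_smul]
  congr 1
  generalize (powerSumEquiv K).symm P = F
  conv_rhs => rw [F.as_sum, map_sum, Finset.smul_sum]
  rw [MvPolynomial.support_X, Finset.sum_singleton]
  refine Finset.sum_congr rfl fun μ _ => ?_
  rw [MvPolynomial.pderiv_monomial, MvPolynomial.smul_monomial, MvPolynomial.coeff_X,
    if_pos rfl, one_mul]
  split_ifs with hle
  · congr 1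
    obtain ⟨ν, rfl⟩ := le_iff_exists_add.1 hle
    rw [add_tsub_cancel_left, zee_single_add, mul_div_cancel_right₀ _ (zee_ne_zero K ν),
      Finsupp.add_apply, Finsupp.single_eq_same, add_comm 1, smul_eq_mul]
    ring
  · have : μ k = 0 := by
      by_contra h0
      exact hle (Finsupp.single_le_iff.2 (Nat.one_le_iff_ne_zero.2 h0))
    rw [this]; simp

-- The chain rule v d/dv P[X+v] = ∑_k k v^k (∂P/∂p_k)[X+v]: both sides are derivations along the
-- translation, so power sums suffice. The sum over all k is cut off at N, whence a congruence
-- modulo v^(N+1).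
open Polynomial in
theorem X_pow_dvd_translate_derivative (N : ℕ) (P : SymFn K) :
    X ^ (N + 1) ∣ X * derivative (translate K P) - ∑ k ∈ Finset.range N,
      C (((k + 1 : ℕ) : SymFn K)) * X ^ (k + 1) * translate K (psumDeriv k.succPNat P) := by
  induction P using symFn_induction with
  | hC r =>
    rw [AlgHom.commutes]
    simp only [psumDeriv_algebraMap, map_zero, mul_zero, Finset.sum_const_zero, sub_zero]
    rw [Polynomial.algebraMap_apply, derivative_C, mul_zero]
    exact dvd_zero _
  | hadd P Q hP hQ =>
    have := dvd_add hP hQ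
    convert this using 1
    simp only [map_add, mul_add, Finset.sum_add_distrib]
    ring
  | hmul P j hP =>
    have hj : X ^ (N + 1) ∣ X * derivative (translate K (psum K j)) - ∑ k ∈ Finset.range N,
        C (((k + 1 : ℕ) : SymFn K)) * X ^ (k + 1) *
          translate K (psumDeriv k.succPNat (psum K j)) := by
      have h1 : X * derivative (translate K (psum K j)) =
          C (((j : ℕ) : SymFn K)) * X ^ (j : ℕ) := by
        rw [translate_psum, derivative_add, derivative_C, zero_add, derivative_X_pow]
        conv_rhs => rw [← Nat.sub_add_cancel j.pos, pow_succ]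
        rw [Nat.sub_add_cancel j.pos]
        ring
      rw [h1]
      simp only [psumDeriv_psum]
      -- If j > N the sum misses the term k = j, but j v^j is itself divisible by v^(N+1).
      rcases Nat.lt_or_ge N j with hlt | hge
      · rw [Finset.sum_eq_zero, sub_zero]
        · exact dvd_mul_of_dvd_right (pow_dvd_pow X hlt) _
        · intro k hk
          rw [Finset.mem_range] at hk
          rw [if_neg, map_zero, mul_zero]
          rintro rfl
          rw [Nat.succPNat_coe] at hlt
          omega
      · have hj1 := j.pos
        rw [Finset.sum_eq_single (j.natPred)]
        · rw [PNat.succPNat_natPred, if_pos rfl, map_one, mul_one, PNat.natPred_add_one, sub_self]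
          exact dvd_zero _
        · intro k _ hk
          rw [if_neg, map_zero, mul_zero]
          rintro rfl
          exact hk (by simp)
        · intro h
          exfalso
          apply h
          rw [Finset.mem_range, PNat.natPred]
          omega
    have := dvd_add (dvd_mul_of_dvd_right hj (translate K P))
      (dvd_mul_of_dvd_right hP (translate K (psum K j)))
    convert this using 1
    simp only [map_mul, psumDeriv_mul, map_add, derivative_mul, mul_add, Finset.sum_add_distrib,
      mul_sub, Finset.mul_sum]
    have e1 : ∀ A B : SymFn K, ∑ k ∈ Finset.range N, C (((k + 1 : ℕ) : SymFn K)) * X ^ (k + 1) *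
        (translate K A * translate K (psumDeriv k.succPNat B)) =
        ∑ k ∈ Finset.range N, translate K A * (C (((k + 1 : ℕ) : SymFn K)) * X ^ (k + 1) *
        (translate K (psumDeriv k.succPNat B))) :=
      fun A B => Finset.sum_congr rfl fun k _ => by ring
    rw [e1, e1]
    ring

/-- Since k ∂/∂p_k = p_k^⊥, this is Newton's recursion for the coefficients of P[X+v], the same one
that the operators h_n^⊥ satisfy. -/
theorem nsmul_coeff_translate (n : ℕ) (P : SymFn K) :
    ((n + 1 : ℕ) : K) • (translate K P).coeff (n + 1) = ∑ k ∈ Finset.range (n + 1),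
      (translate K (((k + 1 : ℕ) : K) • psumDeriv k.succPNat P)).coeff (n - k) := by
  obtain ⟨Q, hQ⟩ := X_pow_dvd_translate_derivative (n + 1) P
  have h := congrArg (fun F => Polynomial.coeff F (n + 1)) hQ
  rw [Polynomial.coeff_X_pow_mul', if_neg (by omega), Polynomial.coeff_sub, sub_eq_zero,
    Polynomial.coeff_X_mul, Polynomial.coeff_derivative, Polynomial.finsetSum_coeff] at h
  rw [Nat.cast_smul_eq_nsmul, nsmul_eq_mul, mul_comm]
  push_cast
  rw [h]
  refine Finset.sum_congr rfl fun k hk => ?_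
  rw [Finset.mem_range] at hk
  rw [mul_assoc, Polynomial.coeff_C_mul, Polynomial.coeff_X_pow_mul', if_pos (by omega), map_smul,
    Polynomial.coeff_smul, show n + 1 - (k + 1) = n - k by omega]
  rw [← Nat.cast_add_one, Nat.cast_smul_eq_nsmul, nsmul_eq_mul]

theorem coeff_zero_translate (P : SymFn K) : (translate K P).coeff 0 = P := by
  have : (Polynomial.constantCoeff).comp (translate K).toRingHom = RingHom.id (SymFn K) := by
    refine symFn_ringHom_ext (fun r => ?_) (fun k => ?_)
    · change Polynomial.constantCoeff (translate K (algebraMap K _ r)) = _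
      rw [AlgHom.commutes]
      simp [Polynomial.algebraMap_apply]
    · change Polynomial.constantCoeff (translate K (psum K k)) = _
      rw [translate_psum]
      simp [k.ne_zero.symm]
  exact RingHom.congr_fun this P

/-- `h_n^⊥ P` is the coefficient of `v^n` in `P[X + v]`. -/
theorem skew_hsymm (n : ℕ) (P : SymFn K) : skew (hsymm K n) P = (translate K P).coeff n := by
  induction n using Nat.strong_induction_on generalizing P with
  | _ n ih =>
    cases n with
    | zero => rw [hsymm_zero, skew_one, coeff_zero_translate]
    | succ n =>
      refine smul_succ_injective (K := K) _ n ?_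
      rw [← smul_skew, newton_hsymm, ← skewHom_apply, map_sum, LinearMap.sum_apply]
      rw [← Nat.cast_add_one, nsmul_coeff_translate]
      refine Finset.sum_congr rfl fun k hk => ?_
      rw [Finset.mem_range] at hk
      rw [skewHom_apply, mul_comm, skew_mul, skew_psum, ih (n - k) (by omega)]
      rfl

end Skew

/-! ### Formal series -/

section Series

attribute [local instance] symFnRing symFnNeg symFnSub

variable {Γ : Type*} [AddCommGroup Γ] [PartialOrder Γ] [IsOrderedAddMonoid Γ]

theorem coeff_powerSeriesAt_nsmul {R : Type*} [CommRing R] (g : Γ) (hg : 0 < g) (a : ℕ → R)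
    (n : ℕ) : (powerSeriesAt g hg a).coeff (n • g) = a n := by
  have := HahnSeries.embDomain_coeff
    (f := (⟨⟨fun n : ℕ => n • g, (nsmul_left_strictMono hg).injective⟩,
      (nsmul_left_strictMono hg).le_iff_le⟩ : ℕ ↪o Γ))
    (x := HahnSeries.toPowerSeries.symm (PowerSeries.mk a)) (a := n)
  rw [HahnSeries.coeff_toPowerSeries_symm, PowerSeries.coeff_mk] at this
  exact this

theorem exists_nsmul_of_coeff_powerSeriesAt {R : Type*} [CommRing R] {g : Γ} {hg : 0 < g}
    {a : ℕ → R} {x : Γ} (hx : (powerSeriesAt g hg a).coeff x ≠ 0) : ∃ n : ℕ, n • g = x := by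
  by_contra h
  refine hx (HahnSeries.embDomain_of_notMem_range ?_)
  rintro ⟨n, hn⟩
  exact h ⟨n, hn⟩

variable {K : Type*} [Field K] [CharZero K]

/-- The series whose exponents lie in a given submonoid. -/
noncomputable def suppIn (K : Type*) [Field K] (T : AddSubmonoid Γ) :
    Subalgebra K (HahnSeries Γ (SymFn K)) where
  carrier := {F | ∀ g, F.coeff g ≠ 0 → g ∈ T}
  mul_mem' := by
    intro F G hF hG g hg
    rw [HahnSeries.coeff_mul] at hg
    obtain ⟨x, hx, hne⟩ := Finset.exists_ne_zero_of_sum_ne_zero hg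
    rw [← (Finset.mem_antidiagonal.1 hx).2.2]
    exact T.add_mem (hF _ (left_ne_zero_of_mul hne)) (hG _ (right_ne_zero_of_mul hne))
  add_mem' := by
    intro F G hF hG g hg
    by_contra hT
    refine hg ?_
    rw [HahnSeries.coeff_add, not_not.1 fun h => hT (hF g h), not_not.1 fun h => hT (hG g h),
      add_zero]
  algebraMap_mem' := by
    intro r g hg
    rw [HahnSeries.algebraMap_apply, HahnSeries.C_apply] at hg
    by_contra hT
    refine hg (HahnSeries.coeff_single_of_ne ?_)
    rintro rfl
    exact hT T.zero_mem

omit [CharZero K] in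
theorem single_mem_suppIn {T : AddSubmonoid Γ} {g : Γ} (hg : g ∈ T) (a : SymFn K) :
    HahnSeries.single g a ∈ suppIn K T := by
  intro x hx
  by_contra hT
  refine hx (HahnSeries.coeff_single_of_ne ?_)
  rintro rfl
  exact hT hg

theorem OmegaNeg_mem_suppIn {T : AddSubmonoid Γ} {g : Γ} (h0 : 0 < g) (hg : g ∈ T) :
    OmegaNeg K g h0 ∈ suppIn K T := by
  intro x hx
  obtain ⟨n, rfl⟩ := exists_nsmul_of_coeff_powerSeriesAt hx
  exact T.nsmul_mem hg n

theorem pleth_mem {A : Type*} [CommRing A] [Algebra K A] (B : Subalgebra K A) {E : ℕ+ → A}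
    (hE : ∀ k, E k ∈ B) (P : SymFn K) : pleth E P ∈ B := by
  induction P using symFn_induction with
  | hC r => rw [AlgHom.commutes]; exact B.algebraMap_mem r
  | hadd P Q hP hQ => rw [map_add]; exact B.add_mem hP hQ
  | hmul P k hP => rw [map_mul, pleth_psum]; exact B.mul_mem hP (hE k)

/-- The coefficientwise translation of a formal series, as a power series in `v`. -/
noncomputable def hahnTranslate (K : Type*) [Field K] [CharZero K] (Γ : Type*) [AddCommGroup Γ]
    [PartialOrder Γ] [IsOrderedAddMonoid Γ] :
    HahnSeries Γ (SymFn K) →+* PowerSeries (HahnSeries Γ (SymFn K)) where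
  -- The degree in v may be unbounded over the coefficients of F, so the values are power series.
  -- The coefficient of v^n is h_n^⊥ applied to every coefficient of F.
  toFun F := PowerSeries.mk fun n => F.map (skewHom K (hsymm K n))
  map_one' := by
    classical
    ext n : 1
    refine HahnSeries.ext (funext fun g => ?_)
    rw [PowerSeries.coeff_mk, HahnSeries.map_coeff, skewHom_apply, skew_hsymm,
      HahnSeries.coeff_one, PowerSeries.coeff_one]
    split_ifs with h1 h2 h2
    · rw [map_one, h2, Polynomial.coeff_one_zero, HahnSeries.coeff_one, if_pos h1]
    · rw [map_one, Polynomial.coeff_one, if_neg h2, HahnSeries.coeff_zero]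
    · rw [map_zero, Polynomial.coeff_zero, HahnSeries.coeff_one, if_neg h1]
    · rw [map_zero, Polynomial.coeff_zero, HahnSeries.coeff_zero]
  map_zero' := by
    ext n : 1
    refine HahnSeries.ext (funext fun g => ?_)
    rw [PowerSeries.coeff_mk, HahnSeries.map_coeff, HahnSeries.coeff_zero, map_zero]
    rfl
  map_add' F G := by
    ext n : 1
    refine HahnSeries.ext (funext fun g => ?_)
    rw [map_add, PowerSeries.coeff_mk, PowerSeries.coeff_mk, PowerSeries.coeff_mk,
      HahnSeries.coeff_add, HahnSeries.map_coeff, HahnSeries.map_coeff, HahnSeries.map_coeff,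
      HahnSeries.coeff_add, map_add]
  map_mul' F G := by
    ext n : 1
    refine HahnSeries.ext (funext fun g => ?_)
    rw [PowerSeries.coeff_mul, PowerSeries.coeff_mk, HahnSeries.map_coeff, HahnSeries.coeff_mul,
      HahnSeries.coeff_sum, map_sum]
    have h1 : ∀ p ∈ Finset.HasAntidiagonal.antidiagonal n,
        (PowerSeries.coeff p.1 (PowerSeries.mk fun n => F.map (skewHom K (hsymm K n))) *
          PowerSeries.coeff p.2 (PowerSeries.mk fun n => G.map (skewHom K (hsymm K n)))).coeff g =
        ∑ x ∈ Finset.antidiagonal F.isPWO_support G.isPWO_support g,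
          (translate K (F.coeff x.1)).coeff p.1 * (translate K (G.coeff x.2)).coeff p.2 := by
      intro p _
      -- The operators h_k^⊥ can only shrink supports, so all convolutions may be indexed by the
      -- supports of F and G, after which multiplicativity is that of `translate`.
      have sub : ∀ (H : HahnSeries Γ (SymFn K)) (k : ℕ),
          (H.map (skewHom K (hsymm K k))).support ⊆ H.support := by
        intro H k x hx h0
        refine hx ?_
        change skewHom K (hsymm K k) (H.coeff x) = 0
        rw [h0, map_zero]
      rw [PowerSeries.coeff_mk, PowerSeries.coeff_mk,
        HahnSeries.coeff_mul_left' F.isPWO_support (sub F p.1)]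
      refine (Finset.sum_subset ?_ ?_).trans (Finset.sum_congr rfl fun x _ => ?_)
      · intro x hx
        rw [Finset.mem_antidiagonal] at hx ⊢
        exact ⟨hx.1, sub G p.2 hx.2.1, hx.2.2⟩
      · intro x hx hx'
        rw [Finset.mem_antidiagonal] at hx hx'
        have : (G.map (skewHom K (hsymm K p.2))).coeff x.2 = 0 := by
          by_contra h0
          exact hx' ⟨hx.1, h0, hx.2.2⟩
        rw [this, mul_zero]
      · rw [HahnSeries.map_coeff, HahnSeries.map_coeff, skewHom_apply, skewHom_apply, skew_hsymm,
          skew_hsymm]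
    rw [Finset.sum_congr rfl h1, Finset.sum_comm]
    refine Finset.sum_congr rfl fun x _ => ?_
    rw [skewHom_apply, skew_hsymm, map_mul, Polynomial.coeff_mul]

theorem coeff_coeff_hahnTranslate (F : HahnSeries Γ (SymFn K)) (n : ℕ) (g : Γ) :
    (PowerSeries.coeff n (hahnTranslate K Γ F)).coeff g = (translate K (F.coeff g)).coeff n := by
  rw [← skew_hsymm]
  change (PowerSeries.coeff n (PowerSeries.mk fun n => F.map (skewHom K (hsymm K n)))).coeff g = _
  rw [PowerSeries.coeff_mk]
  rfl

theorem hahnTranslate_single_algebraMap (g : Γ) (r : K) :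
    hahnTranslate K Γ (HahnSeries.single g (algebraMap K (SymFn K) r)) =
      PowerSeries.C (HahnSeries.single g (algebraMap K (SymFn K) r)) := by
  classical
  ext n : 1
  refine HahnSeries.ext (funext fun x => ?_)
  rw [coeff_coeff_hahnTranslate, PowerSeries.coeff_C, HahnSeries.coeff_single]
  split_ifs with h1 h2 h2
  · rw [AlgHom.commutes, Polynomial.algebraMap_apply, h2, Polynomial.coeff_C_zero,
      HahnSeries.coeff_single, if_pos h1]
  · rw [AlgHom.commutes, Polynomial.algebraMap_apply, Polynomial.coeff_C, if_neg h2,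
      HahnSeries.coeff_zero]
  · rw [map_zero, Polynomial.coeff_zero, HahnSeries.coeff_single, if_neg h1]
  · rw [map_zero, Polynomial.coeff_zero, HahnSeries.coeff_zero]

theorem hahnTranslate_single_one (g : Γ) :
    hahnTranslate K Γ (HahnSeries.single g 1) = PowerSeries.C (HahnSeries.single g 1) := by
  have := hahnTranslate_single_algebraMap (K := K) g 1
  rwa [map_one] at this

theorem hahnTranslate_C (f : SymFn K) : hahnTranslate K Γ (HahnSeries.C f) =
    ((translate K f).map HahnSeries.C : Polynomial (HahnSeries Γ (SymFn K))) := by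
  classical
  ext n : 1
  refine HahnSeries.ext (funext fun x => ?_)
  rw [coeff_coeff_hahnTranslate, Polynomial.coeff_coe, Polynomial.coeff_map, HahnSeries.C_apply,
    HahnSeries.C_apply, HahnSeries.coeff_single, HahnSeries.coeff_single]
  split_ifs with h
  · rfl
  · rw [map_zero, Polynomial.coeff_zero]

theorem coeff_OmegaNeg_nsmul (g : Γ) (hg : 0 < g) (n : ℕ) :
    (OmegaNeg K g hg).coeff (n • g) = hNeg K n := coeff_powerSeriesAt_nsmul g hg _ n

/-- `Ω[-z (X + v)] = Ω[-z X] (1 - z v)`. -/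
theorem hahnTranslate_OmegaNeg (g : Γ) (hg : 0 < g) :
    hahnTranslate K Γ (OmegaNeg K g hg) = PowerSeries.C (OmegaNeg K g hg) *
      (1 - PowerSeries.C (HahnSeries.single g 1) * PowerSeries.X) := by
  classical
  ext n : 1
  refine HahnSeries.ext (funext fun x => ?_)
  have key : ∀ j : ℕ, (HahnSeries.single g 1 * OmegaNeg K g hg).coeff ((j + 1) • g) =
      hNeg K j := by
    intro j
    rw [HahnSeries.coeff_single_mul, one_mul, ← coeff_OmegaNeg_nsmul g hg, succ_nsmul,
      add_sub_cancel_right]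
  have key0 : (HahnSeries.single g 1 * OmegaNeg K g hg).coeff (0 • g) = 0 := by
    rw [HahnSeries.coeff_single_mul, one_mul]
    by_contra h
    obtain ⟨n, hn⟩ := exists_nsmul_of_coeff_powerSeriesAt h
    rw [zero_nsmul, zero_sub, eq_neg_iff_add_eq_zero, ← succ_nsmul] at hn
    exact (nsmul_pos hg (Nat.succ_ne_zero n)).ne' hn
  have hr : PowerSeries.C (OmegaNeg K g hg) *
      (1 - PowerSeries.C (HahnSeries.single g 1) * PowerSeries.X) =
      PowerSeries.C (OmegaNeg K g hg) -
        PowerSeries.C (HahnSeries.single g 1 * OmegaNeg K g hg) * PowerSeries.X := by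
    rw [map_mul]; ring
  rw [coeff_coeff_hahnTranslate, hr, map_sub, HahnSeries.coeff_sub]
  by_cases hx : ∃ j : ℕ, j • g = x
  · obtain ⟨j, rfl⟩ := hx
    rw [coeff_OmegaNeg_nsmul]
    have hj : translate K (hNeg K j) = Polynomial.C (hNeg K j) - Polynomial.X *
        Polynomial.C ((HahnSeries.single g 1 * OmegaNeg K g hg).coeff (j • g)) := by
      cases j with
      | zero => rw [key0, map_zero, mul_zero, sub_zero, translate_hNeg_zero]
      | succ j => rw [key, translate_hNeg_succ]
    rw [hj]
    match n with
    | 0 => simp [coeff_OmegaNeg_nsmul]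
    | 1 => simp
    | n + 2 => simp
  · have h1 : (OmegaNeg K g hg).coeff x = 0 := by
      by_contra h; exact hx (exists_nsmul_of_coeff_powerSeriesAt h)
    have h2 : (HahnSeries.single g 1 * OmegaNeg K g hg).coeff x = 0 := by
      rw [HahnSeries.coeff_single_mul, one_mul]
      by_contra h
      obtain ⟨j, hj⟩ := exists_nsmul_of_coeff_powerSeriesAt h
      exact hx ⟨j + 1, by rw [succ_nsmul, hj, sub_add_cancel]⟩
    rw [h1, map_zero, Polynomial.coeff_zero]
    match n with
    | 0 => simp [h1]
    | 1 => simp [PowerSeries.coeff_C, h2]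
    | n + 2 => simp

end Series

/-! ### The operators `STilde` as coefficients -/

section STilde

attribute [local instance] symFnRing symFnNeg symFnSub

variable {K : Type*} [Field K] [CharZero K]

/-- The coefficient of `z^a` in `P[X + 1/z] Ω[-z X]`. -/
noncomputable def vertexOp (a : ℕ) (P : SymFn K) : SymFn K :=
  (translate K P).sum fun n f => hNeg K (a + n) * f

theorem vertexOp_eq_sum (a : ℕ) (P : SymFn K) {N : ℕ} (hN : (translate K P).natDegree < N) :
    vertexOp a P = ∑ n ∈ Finset.range N, hNeg K (a + n) * (translate K P).coeff n :=
  Polynomial.sum_over_range' _ (fun _ => mul_zero _) N hN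

theorem omega_omega (P : SymFn K) : omega (omega P) = P := by
  have : (omega : SymFn K →ₐ[K] SymFn K).toRingHom.comp (omega : SymFn K →ₐ[K] SymFn K).toRingHom
      = RingHom.id _ := by
    refine symFn_ringHom_ext (fun r => ?_) (fun k => ?_)
    · simp
    · change omega (omega (psum K k)) = psum K k
      rw [omega, pleth_psum, map_mul, pleth_psum, map_pow, map_neg, map_one, ← mul_assoc,
        ← mul_pow, neg_one_mul, neg_neg, one_pow, one_mul]
  exact RingHom.congr_fun this P

-- Over `ℤ` the algebra structure in use passes through power series; it is identified here with
-- constant series.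
omit [CharZero K] in
theorem algebraMap_hahnSeries_int (r : K) :
    algebraMap K (HahnSeries ℤ (SymFn K)) r = HahnSeries.C (algebraMap K (SymFn K) r) := by
  rw [HahnSeries.algebraMap_apply', ← HahnSeries.ofPowerSeries_C]
  congr 1
  rw [PowerSeries.algebraMap_apply]

-- Both sides are ring homomorphisms sending p_k to (-1)^(k-1)(p_k - z^(-k)): the substitution v =
-- -1/z turns v^k into (-1)^k z^(-k).
open Polynomial in
theorem pleth_sub_omega (P : SymFn K) :
    pleth (fun k : ℕ+ => HahnSeries.C (psum K k) - HahnSeries.single (-((k : ℕ) : ℤ)) 1)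
      (omega P) = eval₂ (HahnSeries.C.comp (omega : SymFn K →ₐ[K] SymFn K).toRingHom)
        (-HahnSeries.single (-1 : ℤ) (1 : SymFn K)) (translate K P) := by
  have : (pleth (fun k : ℕ+ => HahnSeries.C (psum K k) -
      HahnSeries.single (-((k : ℕ) : ℤ)) 1) : SymFn K →ₐ[K] HahnSeries ℤ (SymFn K)).toRingHom.comp
      (omega : SymFn K →ₐ[K] SymFn K).toRingHom =
      (eval₂RingHom (HahnSeries.C.comp (omega : SymFn K →ₐ[K] SymFn K).toRingHom)
        (-HahnSeries.single (-1 : ℤ) (1 : SymFn K))).comp (translate K).toRingHom := by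
    refine symFn_ringHom_ext (A := HahnSeries ℤ (SymFn K)) (fun r => ?_) (fun k => ?_)
    · simp only [AlgHom.toRingHom_eq_coe, RingHom.comp_apply, RingHom.coe_coe, coe_eval₂RingHom]
      rw [AlgHom.commutes, AlgHom.commutes, AlgHom.commutes, Polynomial.algebraMap_apply, eval₂_C]
      change _ = HahnSeries.C (omega (algebraMap K _ r))
      rw [AlgHom.commutes, algebraMap_hahnSeries_int]
    · simp only [AlgHom.toRingHom_eq_coe, RingHom.comp_apply, RingHom.coe_coe, coe_eval₂RingHom]
      have h0 : omega (psum K k) = (-1) ^ ((k : ℕ) - 1) * psum K k := pleth_psum _ _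
      have h4 : pleth (fun k : ℕ+ => HahnSeries.C (psum K k) -
          HahnSeries.single (-((k : ℕ) : ℤ)) 1) ((-1) ^ ((k : ℕ) - 1) : SymFn K) =
          (-1) ^ ((k : ℕ) - 1) := by
        exact (map_pow _ _ _).trans (congrArg (· ^ ((k : ℕ) - 1))
          ((map_neg _ _).trans (congrArg Neg.neg (map_one _))))
      have h5 : HahnSeries.C ((-1) ^ ((k : ℕ) - 1) : SymFn K) =
          ((-1) ^ ((k : ℕ) - 1) : HahnSeries ℤ (SymFn K)) := by
        rw [map_pow, map_neg, RingHom.map_one]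
      rw [h0, translate_psum, map_mul, pleth_psum, h4, eval₂_add, eval₂_C, eval₂_X_pow]
      change _ = HahnSeries.C (omega (psum K k)) + _
      have h1 : (-HahnSeries.single (-1 : ℤ) (1 : SymFn K)) ^ (k : ℕ) =
          -((-1) ^ ((k : ℕ) - 1) * HahnSeries.single (-((k : ℕ) : ℤ)) 1) := by
        rw [← HahnSeries.single_neg, HahnSeries.single_pow, ← h5, HahnSeries.C_apply,
          HahnSeries.single_mul_single, ← HahnSeries.single_neg, zero_add, mul_one]
        conv_lhs => rw [← Nat.sub_add_cancel k.pos, pow_succ, mul_neg_one]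
        rw [Nat.sub_add_cancel k.pos]
        congr 1
        simp
      rw [h0, RingHom.map_mul, h5, h1, mul_sub, sub_eq_add_neg]
  exact RingHom.congr_fun this P

/-- The outer ω turns h_{a+n} into (-1)^(a+n) h_{a+n}[-X], and the sign (-1)^n cancels against that
of (-1/z)^n. -/
theorem STilde_natCast (a : ℕ) (P : SymFn K) :
    STilde (a : ℤ) P = (-1) ^ a * vertexOp a P := by
  rw [STilde, S, pleth_sub_omega, Polynomial.eval₂_eq_sum_range, Finset.sum_mul,
    HahnSeries.coeff_sum, map_sum, vertexOp_eq_sum a P (Nat.lt_succ_self _), Finset.mul_sum]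
  refine Finset.sum_congr rfl fun n _ => ?_
  have h1 : (-HahnSeries.single (-1 : ℤ) (1 : SymFn K)) ^ n =
      HahnSeries.single (-(n : ℤ)) ((-1) ^ n) := by
    rw [← HahnSeries.single_neg, HahnSeries.single_pow]
    simp
  have h2 : (Omega K (1 : ℤ) one_pos).coeff ((a : ℤ) - -(n : ℤ)) = hsymm K (a + n) := by
    have := coeff_powerSeriesAt_nsmul (1 : ℤ) one_pos (hsymm K) (a + n)
    rw [← this, Omega]
    congr 1
    simp
  rw [h1, mul_assoc, RingHom.comp_apply, HahnSeries.C_mul_eq_smul, HahnSeries.coeff_smul, HahnSeries.coeff_single_mul,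
    h2, smul_eq_mul, map_mul, map_mul, map_pow, map_neg, map_one, omega_hsymm]
  change omega (omega _) * _ = _
  rw [omega_omega, pow_add]
  have h3 : ((-1) ^ n * (-1) ^ n : SymFn K) = 1 := by rw [← mul_pow]; simp
  linear_combination (translate K P).coeff n * (-1) ^ a * hNeg K (a + n) * h3

end STilde

/-! ### Normal ordering of products of operators -/

section Words

attribute [local instance] symFnRing symFnNeg symFnSub

variable {K : Type*} [Field K] [CharZero K] {m : ℕ}

theorem update_eq_sub_nsmul (g : Fin m → ℤ) (i : Fin m) (k : ℕ) (hk : g i = k) :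
    Function.update g i 0 = g - k • zExp i := by
  funext j
  by_cases hj : j = i
  · subst hj; simp [zExp, hk]
  · simp [zExp, hj]

theorem update_eq_add_nsmul (g : Fin m → ℤ) (i : Fin m) (k : ℕ) (hk : g i = -(k : ℤ)) :
    Function.update g i 0 = g + k • zExp i := by
  funext j
  by_cases hj : j = i
  · subst hj; simp [zExp, hk]
  · simp [zExp, hj]

theorem nsmul_zExp_apply_self (k : ℕ) (i : Fin m) : (k • zExp i) i = (k : ℤ) := by simp [zExp]

/-- As z_i does not occur in H, only the term z_i^k of Ω[-z_i X] contributes. -/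
theorem coeff_OmegaNeg_mul (i : Fin m) {H : HahnSeries (Fin m → ℤ) (SymFn K)}
    (hH : ∀ g, H.coeff g ≠ 0 → g i = 0) (g : Fin m → ℤ) (k : ℕ) (hk : g i = k) :
    (OmegaNeg K (zExp i) (zExp_pos i) * H).coeff g =
      hNeg K k * H.coeff (Function.update g i 0) := by
  classical
  rw [HahnSeries.coeff_mul, Finset.sum_eq_single (k • zExp i, Function.update g i 0)]
  · rw [coeff_OmegaNeg_nsmul]
  · rintro ⟨a, b⟩ hab hne
    by_contra h0
    obtain ⟨n, hn⟩ := exists_nsmul_of_coeff_powerSeriesAt (left_ne_zero_of_mul h0)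
    have hb := hH b (right_ne_zero_of_mul h0)
    have hs := (Finset.mem_antidiagonal.1 hab).2.2
    simp only at hn hs
    have h1 := congrFun hs i
    rw [Pi.add_apply, hb, ← hn, nsmul_zExp_apply_self, hk, add_zero] at h1
    have h2 : n = k := by exact_mod_cast h1
    subst h2
    refine hne (Prod.ext hn.symm ?_)
    rw [update_eq_sub_nsmul g i n hk, hn, ← hs, add_sub_cancel_left]
  · intro h
    by_contra h0
    refine h (Finset.mem_antidiagonal.2 ⟨left_ne_zero_of_mul h0, right_ne_zero_of_mul h0, ?_⟩)
    rw [update_eq_sub_nsmul g i k hk, add_sub_cancel]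

/-! ### Adjoining one letter to a normally ordered series -/

section Step

variable {i : Fin m} {F : HahnSeries (Fin m → ℤ) (SymFn K)}
  {Φ : Polynomial (HahnSeries (Fin m → ℤ) (SymFn K))}

/-- Requiring the translate of F to be a polynomial Φ in v, not merely a power series, makes the
substitution v = 1/z_i available. -/
theorem coeff_coeff_of_hahnTranslate (hΦ : hahnTranslate K _ F = Φ) (n : ℕ) (g : Fin m → ℤ) :
    (Φ.coeff n).coeff g = (translate K (F.coeff g)).coeff n := by
  rw [← coeff_coeff_hahnTranslate, hΦ, Polynomial.coeff_coe]

theorem coeff_coeff_ne_zero (hΦ : hahnTranslate K _ F = Φ) (hF : ∀ g, F.coeff g ≠ 0 → g i = 0)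
    (n : ℕ) (g : Fin m → ℤ) (h : (Φ.coeff n).coeff g ≠ 0) : g i = 0 := by
  refine hF g fun h0 => h ?_
  rw [coeff_coeff_of_hahnTranslate hΦ, h0, map_zero, Polynomial.coeff_zero]

omit [CharZero K] in
theorem coeff_mul_eval_inv (Q : HahnSeries (Fin m → ℤ) (SymFn K)) (c : Fin m → ℤ) :
    (Q * Φ.eval (HahnSeries.single (-zExp i) 1)).coeff c =
      ∑ n ∈ Finset.range (Φ.natDegree + 1), (Q * Φ.coeff n).coeff (c + n • zExp i) := by
  rw [Polynomial.eval_eq_sum_range, Finset.mul_sum, HahnSeries.coeff_sum]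
  refine Finset.sum_congr rfl fun n _ => ?_
  rw [HahnSeries.single_pow, ← mul_assoc, HahnSeries.coeff_mul_single, one_pow, mul_one, smul_neg,
    sub_neg_eq_add]

/-- F is free of z_i, so z_i^(-k) comes only from v^k, whose coefficient is k-th skewing. Positive
powers of z_i are absent, in agreement with h_n = 0 for n < 0. -/
theorem coeff_eval_inv (hΦ : hahnTranslate K _ F = Φ) (hF : ∀ g, F.coeff g ≠ 0 → g i = 0)
    (c : Fin m → ℤ) : (Φ.eval (HahnSeries.single (-zExp i) 1)).coeff c =
      skew (hInt K (-(c i))) (F.coeff (Function.update c i 0)) := by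
  rw [← one_mul (Φ.eval _), coeff_mul_eval_inv]
  simp only [one_mul]
  by_cases hc : 0 ≤ -(c i)
  · obtain ⟨k, hk⟩ := Int.eq_ofNat_of_zero_le hc
    have hk' : c i = -(k : ℤ) := by omega
    rw [hInt, if_pos hc, hk, Int.toNat_natCast, skew_hsymm, update_eq_add_nsmul c i k hk',
      ← coeff_coeff_of_hahnTranslate hΦ]
    refine Finset.sum_eq_single k (fun n _ hn => ?_) (fun hn => ?_)
    · by_contra h0
      have := coeff_coeff_ne_zero hΦ hF _ _ h0
      rw [Pi.add_apply, nsmul_zExp_apply_self] at this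
      omega
    · rw [Finset.mem_range, not_lt] at hn
      rw [Polynomial.coeff_eq_zero_of_natDegree_lt (by omega), HahnSeries.coeff_zero]
  · rw [hInt, if_neg hc, ← skewHom_apply, map_zero, LinearMap.zero_apply]
    refine Finset.sum_eq_zero fun n _ => ?_
    by_contra h0
    have := coeff_coeff_ne_zero hΦ hF _ _ h0
    rw [Pi.add_apply, nsmul_zExp_apply_self] at this
    omega

/-- A term v^n contributes z_i^(-n), so Ω[-z_i X] has to supply z_i^(a+n); this is the sum defining
`vertexOp`. -/
theorem coeff_OmegaNeg_mul_eval_inv (hΦ : hahnTranslate K _ F = Φ)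
    (hF : ∀ g, F.coeff g ≠ 0 → g i = 0) (c : Fin m → ℤ) (a : ℕ) (ha : c i = a) :
    (OmegaNeg K (zExp i) (zExp_pos i) * Φ.eval (HahnSeries.single (-zExp i) 1)).coeff c =
      vertexOp a (F.coeff (Function.update c i 0)) := by
  rw [coeff_mul_eval_inv, vertexOp_eq_sum (N := Φ.natDegree + 1)]
  · refine Finset.sum_congr rfl fun n _ => ?_
    rw [coeff_OmegaNeg_mul i (coeff_coeff_ne_zero hΦ hF n) _ (a + n)]
    · rw [coeff_coeff_of_hahnTranslate hΦ]
      congr 4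
      funext j
      by_cases hj : j = i
      · subst hj; simp
      · simp [zExp, hj]
    · rw [Pi.add_apply, nsmul_zExp_apply_self, ha]
      push_cast
      rfl
  · rw [Nat.lt_succ_iff, Polynomial.natDegree_le_iff_coeff_eq_zero]
    intro n hn
    rw [← coeff_coeff_of_hahnTranslate hΦ, Polynomial.coeff_eq_zero_of_natDegree_lt hn,
      HahnSeries.coeff_zero]

end Step

/-- The substitution `P ↦ P[X + ∑_{i ∈ s} 1/z_i]`. -/
noncomputable def plethAddInv (K : Type*) [Field K] [CharZero K] {m : ℕ} (s : Finset (Fin m)) :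
    SymFn K →ₐ[K] HahnSeries (Fin m → ℤ) (SymFn K) :=
  pleth fun k => HahnSeries.C (psum K k) +
    ∑ i ∈ s, HahnSeries.single (-((k : ℕ) • zExp i)) 1

theorem plethAddInv_psum (s : Finset (Fin m)) (k : ℕ+) : plethAddInv K s (psum K k) =
    HahnSeries.C (psum K k) + ∑ i ∈ s, HahnSeries.single (-((k : ℕ) • zExp i)) 1 :=
  pleth_psum _ _

theorem plethAddInv_empty (P : SymFn K) :
    plethAddInv K (∅ : Finset (Fin m)) P = HahnSeries.C P := by
  have : (plethAddInv K (∅ : Finset (Fin m))).toRingHom =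
      (HahnSeries.C : SymFn K →+* HahnSeries (Fin m → ℤ) (SymFn K)) := by
    refine symFn_ringHom_ext (A := HahnSeries (Fin m → ℤ) (SymFn K)) (fun r => ?_) (fun k => ?_)
    · simp only [AlgHom.toRingHom_eq_coe, RingHom.coe_coe]
      rw [AlgHom.commutes, HahnSeries.algebraMap_apply]
    · simp only [AlgHom.toRingHom_eq_coe, RingHom.coe_coe]
      rw [plethAddInv_psum, Finset.sum_empty, add_zero]
  exact RingHom.congr_fun this P

theorem plethAddInv_insert {i : Fin m} {s : Finset (Fin m)} (hi : i ∉ s) (P : SymFn K) :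
    plethAddInv K (insert i s) P = ((translate K P).map (plethAddInv K s).toRingHom).eval
      (HahnSeries.single (-zExp i) 1) := by
  have : (plethAddInv K (insert i s)).toRingHom =
      (Polynomial.eval₂RingHom (plethAddInv K s).toRingHom
        (HahnSeries.single (-zExp i) 1)).comp (translate K).toRingHom := by
    refine symFn_ringHom_ext (A := HahnSeries (Fin m → ℤ) (SymFn K)) (fun r => ?_) (fun k => ?_)
    · simp only [AlgHom.toRingHom_eq_coe, RingHom.coe_coe, RingHom.comp_apply,
        Polynomial.coe_eval₂RingHom]
      rw [AlgHom.commutes, AlgHom.commutes, Polynomial.algebraMap_apply, Polynomial.eval₂_C]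
      simp only [RingHom.coe_coe]
      rw [AlgHom.commutes]
    · simp only [AlgHom.toRingHom_eq_coe, RingHom.coe_coe, RingHom.comp_apply,
        Polynomial.coe_eval₂RingHom]
      rw [plethAddInv_psum, translate_psum, Polynomial.eval₂_add, Polynomial.eval₂_C,
        Polynomial.eval₂_X_pow, Finset.sum_insert hi, HahnSeries.single_pow, one_pow, smul_neg]
      simp only [RingHom.coe_coe]
      rw [plethAddInv_psum]
      ring
  rw [Polynomial.eval_map]
  exact RingHom.congr_fun this P

/-- Translation by v commutes with the translations by the 1/z_i, and the result is a polynomial in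
v. -/
theorem hahnTranslate_plethAddInv (s : Finset (Fin m)) (P : SymFn K) :
    hahnTranslate K _ (plethAddInv K s P) =
      ((translate K P).map (plethAddInv K s).toRingHom : Polynomial _) := by
  have : (hahnTranslate K (Fin m → ℤ)).comp (plethAddInv K s).toRingHom =
      (Polynomial.coeToPowerSeries.ringHom.comp
        (Polynomial.mapRingHom (plethAddInv K s).toRingHom)).comp (translate K).toRingHom := by
    refine symFn_ringHom_ext (A := PowerSeries (HahnSeries (Fin m → ℤ) (SymFn K)))
      (fun r => ?_) (fun k => ?_)
    · simp only [AlgHom.toRingHom_eq_coe, RingHom.coe_coe, RingHom.comp_apply,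
        Polynomial.coe_mapRingHom, Polynomial.coeToPowerSeries.ringHom_apply]
      rw [AlgHom.commutes, AlgHom.commutes, HahnSeries.algebraMap_apply, hahnTranslate_C,
        AlgHom.commutes, Polynomial.algebraMap_apply, Polynomial.map_C, Polynomial.map_C]
      simp only [RingHom.coe_coe]
      rw [AlgHom.commutes, HahnSeries.algebraMap_apply]
    · simp only [AlgHom.toRingHom_eq_coe, RingHom.coe_coe, RingHom.comp_apply,
        Polynomial.coe_mapRingHom, Polynomial.coeToPowerSeries.ringHom_apply]
      rw [plethAddInv_psum, map_add, hahnTranslate_C, translate_psum, Polynomial.map_add,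
        Polynomial.map_add, Polynomial.map_C, Polynomial.map_C, Polynomial.map_pow,
        Polynomial.map_pow, Polynomial.map_X, Polynomial.map_X]
      simp only [RingHom.coe_coe]
      rw [plethAddInv_psum, map_sum, Polynomial.coe_add, Polynomial.coe_add, Polynomial.coe_C,
        Polynomial.coe_C, map_add, map_sum]
      simp only [hahnTranslate_single_one]
      ring
  exact RingHom.congr_fun this P

/-- The composition of operators, the letter `i` contributing the coefficient of `z_i^{c i}` of
`P ↦ P[X + 1/z_i] Ω[-z_i X]` if `i ∈ A`, and of `P ↦ P[X + 1/z_i]` otherwise. -/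
noncomputable def wordOp (A : Finset (Fin m)) (c : Fin m → ℤ) (l : List (Fin m)) (P : SymFn K) :
    SymFn K :=
  l.foldr (fun i Q => if i ∈ A then vertexOp (c i).toNat Q else skew (hInt K (-(c i))) Q) P

theorem wordOp_nil (A : Finset (Fin m)) (c : Fin m → ℤ) (P : SymFn K) : wordOp A c [] P = P := rfl

theorem wordOp_cons (A : Finset (Fin m)) (c : Fin m → ℤ) (i : Fin m) (l : List (Fin m))
    (P : SymFn K) : wordOp A c (i :: l) P =
      if i ∈ A then vertexOp (c i).toNat (wordOp A c l P) else
        skew (hInt K (-(c i))) (wordOp A c l P) := by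
  rw [wordOp, List.foldr_cons]
  rfl

/-- The product of `Ω[-z_i X]` over the letters of a word in `A`. -/
noncomputable def wordOmega (K : Type*) [Field K] [CharZero K] (A : Finset (Fin m))
    (l : List (Fin m)) : HahnSeries (Fin m → ℤ) (SymFn K) :=
  (l.map fun i => if i ∈ A then OmegaNeg K (zExp i) (zExp_pos i) else 1).prod

/-- The product of `1 - z_j / z_i` over the letters `j ∈ A` of a word. -/
noncomputable def wordFactor (K : Type*) [Field K] (A : Finset (Fin m)) (i : Fin m)
    (l : List (Fin m)) : HahnSeries (Fin m → ℤ) (SymFn K) :=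
  (l.map fun j => if j ∈ A then 1 - HahnSeries.single (zExp j - zExp i) 1 else 1).prod

/-- The product of `1 - z_j / z_i` over the pairs of letters of a word with `j ∈ A` after `i`. -/
noncomputable def wordCross (K : Type*) [Field K] (A : Finset (Fin m)) :
    List (Fin m) → HahnSeries (Fin m → ℤ) (SymFn K)
  | [] => 1
  | i :: l => wordFactor K A i l * wordCross K A l

/-- Each letter of A contributes 1 - z_j v; evaluation at v = 1/z_i will turn these factors into
`wordFactor`. -/
theorem hahnTranslate_wordOmega (A : Finset (Fin m)) (l : List (Fin m)) :
    hahnTranslate K _ (wordOmega K A l) = PowerSeries.C (wordOmega K A l) *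
      (l.map fun j => if j ∈ A then
        1 - PowerSeries.C (HahnSeries.single (zExp j) 1) * PowerSeries.X else 1).prod := by
  induction l with
  | nil => simp [wordOmega]
  | cons i l ih =>
    have h : wordOmega K A (i :: l) =
        (if i ∈ A then OmegaNeg K (zExp i) (zExp_pos i) else 1) * wordOmega K A l := by
      rw [wordOmega, List.map_cons, List.prod_cons]; rfl
    rw [h, map_mul, ih, map_mul, List.map_cons, List.prod_cons]
    split_ifs
    · rw [hahnTranslate_OmegaNeg]; ring
    · rw [map_one, map_one]; ring

theorem hahnTranslate_wordFactor (A : Finset (Fin m)) (i : Fin m) (l : List (Fin m)) :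
    hahnTranslate K _ (wordFactor K A i l) = PowerSeries.C (wordFactor K A i l) := by
  unfold wordFactor
  rw [map_list_prod, map_list_prod, List.map_map, List.map_map]
  congr 1
  refine List.map_congr_left fun j _ => ?_
  simp only [Function.comp_apply]
  split_ifs
  · rw [map_sub, map_sub, hahnTranslate_single_one, RingHom.map_one, RingHom.map_one]
  · rw [map_one, map_one]

theorem hahnTranslate_wordCross (A : Finset (Fin m)) (l : List (Fin m)) :
    hahnTranslate K _ (wordCross K A l) = PowerSeries.C (wordCross K A l) := by
  induction l with
  | nil => rw [wordCross, map_one, map_one]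
  | cons i l ih => rw [wordCross, map_mul, map_mul, ih, hahnTranslate_wordFactor]

/-- The exponents not involving `z_i` for `i ∉ s`. -/
def expIn (s : Finset (Fin m)) : AddSubmonoid (Fin m → ℤ) where
  carrier := {g | ∀ i ∉ s, g i = 0}
  add_mem' := by
    intro a b ha hb i hi
    rw [Pi.add_apply, ha i hi, hb i hi, add_zero]
  zero_mem' := fun _ _ => rfl

theorem zExp_mem_expIn {s : Finset (Fin m)} {i : Fin m} (hi : i ∈ s) : zExp i ∈ expIn s := by
  intro j hj
  have : j ≠ i := by rintro rfl; exact hj hi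
  simp [zExp, this]

theorem neg_mem_expIn {s : Finset (Fin m)} {g : Fin m → ℤ} (hg : g ∈ expIn s) :
    -g ∈ expIn s := fun i hi => by rw [Pi.neg_apply, hg i hi, neg_zero]

theorem plethAddInv_mem (s : Finset (Fin m)) (P : SymFn K) :
    plethAddInv K s P ∈ suppIn K (expIn s) := by
  refine pleth_mem (A := HahnSeries (Fin m → ℤ) (SymFn K)) (suppIn K (expIn s)) (fun k => ?_) P
  refine Subalgebra.add_mem _ (single_mem_suppIn (expIn s).zero_mem _)
    (Subalgebra.sum_mem _ fun i hi => single_mem_suppIn ?_ _)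
  exact neg_mem_expIn ((expIn s).nsmul_mem (zExp_mem_expIn hi) _)

theorem wordOmega_mem (A s : Finset (Fin m)) (l : List (Fin m)) (hl : ∀ i ∈ l, i ∈ s) :
    wordOmega K A l ∈ suppIn K (expIn s) := by
  refine Subalgebra.list_prod_mem _ fun x hx => ?_
  obtain ⟨i, hi, rfl⟩ := List.mem_map.1 hx
  split_ifs
  · exact OmegaNeg_mem_suppIn _ (zExp_mem_expIn (hl i hi))
  · exact Subalgebra.one_mem _

omit [CharZero K] in
theorem wordFactor_mem (A s : Finset (Fin m)) (i : Fin m) (his : i ∈ s) (l : List (Fin m))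
    (hl : ∀ i ∈ l, i ∈ s) : wordFactor K A i l ∈ suppIn K (expIn s) := by
  refine Subalgebra.list_prod_mem _ fun x hx => ?_
  obtain ⟨j, hj, rfl⟩ := List.mem_map.1 hx
  split_ifs
  · refine Subalgebra.sub_mem _ (Subalgebra.one_mem _) (single_mem_suppIn ?_ _)
    rw [sub_eq_add_neg]
    exact (expIn s).add_mem (zExp_mem_expIn (hl j hj)) (neg_mem_expIn (zExp_mem_expIn his))
  · exact Subalgebra.one_mem _

omit [CharZero K] in
theorem wordCross_mem (A s : Finset (Fin m)) (l : List (Fin m)) (hl : ∀ i ∈ l, i ∈ s) :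
    wordCross K A l ∈ suppIn K (expIn s) := by
  induction l with
  | nil => exact Subalgebra.one_mem _
  | cons i l ih =>
    have hl' : ∀ j ∈ l, j ∈ s := fun j hj => hl j (List.mem_cons_of_mem _ hj)
    exact Subalgebra.mul_mem _ (wordFactor_mem A s i (hl i List.mem_cons_self) l hl') (ih hl')

theorem wordOp_congr (A : Finset (Fin m)) {c c' : Fin m → ℤ} (l : List (Fin m))
    (h : ∀ i ∈ l, c i = c' i) (P : SymFn K) : wordOp A c l P = wordOp A c' l P := by
  induction l with
  | nil => rw [wordOp_nil, wordOp_nil]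
  | cons i l ih =>
    rw [wordOp_cons, wordOp_cons, ih fun j hj => h j (List.mem_cons_of_mem _ hj),
      h i List.mem_cons_self]

/-- The normally ordered form of a composition of operators. -/
theorem wordOp_eq_coeff (A : Finset (Fin m)) (P : SymFn K) (l : List (Fin m)) (hl : l.Nodup)
    (c : Fin m → ℤ) (hA : ∀ i ∈ l, i ∈ A → 0 ≤ c i) (hc : ∀ i ∉ l, c i = 0) :
    wordOp A c l P =
      (plethAddInv K l.toFinset P * wordOmega K A l * wordCross K A l).coeff c := by
  induction l generalizing c with
  | nil =>
    have : c = 0 := funext fun i => hc i List.not_mem_nil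
    subst this
    simp only [wordOp, wordOmega, wordCross, List.foldr_nil, List.map_nil, List.prod_nil, mul_one,
      List.toFinset_nil]
    rw [plethAddInv_empty, HahnSeries.C_apply, HahnSeries.coeff_single_same]
  | cons i l ih =>
    obtain ⟨hil, hl⟩ := List.nodup_cons.1 hl
    set F := plethAddInv K l.toFinset P * wordOmega K A l * wordCross K A l with hFdef
    -- Only letters of the tail occur in F, and i is not one of them.
    have hF : ∀ g, F.coeff g ≠ 0 → g i = 0 := by
      intro g hg
      have hmem : F ∈ suppIn K (expIn l.toFinset) := Subalgebra.mul_mem _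
        (Subalgebra.mul_mem _ (plethAddInv_mem _ P)
          (wordOmega_mem A _ l fun j hj => List.mem_toFinset.2 hj))
        (wordCross_mem A _ l fun j hj => List.mem_toFinset.2 hj)
      exact hmem g hg i (by rwa [List.mem_toFinset])
    -- The translate of F written explicitly as a polynomial in v: the word without i, with the
    -- factors 1 - z_j v made visible.
    let Φ : Polynomial (HahnSeries (Fin m → ℤ) (SymFn K)) :=
      (translate K P).map (plethAddInv K l.toFinset).toRingHom *
        (Polynomial.C (wordOmega K A l) * (l.map fun j => if j ∈ A then
          1 + Polynomial.C (-HahnSeries.single (zExp j) 1) * Polynomial.X else 1).prod) *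
        Polynomial.C (wordCross K A l)
    have hΦ : hahnTranslate K _ F = Φ := by
      rw [hFdef, map_mul, map_mul, hahnTranslate_plethAddInv, hahnTranslate_wordOmega,
        hahnTranslate_wordCross, Polynomial.coe_mul, Polynomial.coe_mul, Polynomial.coe_mul,
        Polynomial.coe_C, Polynomial.coe_C]
      congr 3
      rw [← Polynomial.coeToPowerSeries.ringHom_apply, map_list_prod, List.map_map]
      congr 1
      refine List.map_congr_left fun j _ => ?_
      simp only [Function.comp_apply, Polynomial.coeToPowerSeries.ringHom_apply]
      split_ifs
      · rw [Polynomial.coe_add, Polynomial.coe_mul, Polynomial.coe_one, Polynomial.coe_C,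
          Polynomial.coe_X, map_neg]
        ring
      · rw [Polynomial.coe_one]
    have hE : Φ.eval (HahnSeries.single (-zExp i) 1) =
        plethAddInv K (i :: l).toFinset P * wordOmega K A l * wordCross K A (i :: l) := by
      have h1 : (((l.map fun j => if j ∈ A then 1 + Polynomial.C (-HahnSeries.single (zExp j)
          (1 : SymFn K)) * Polynomial.X else 1).prod).eval
            (HahnSeries.single (-zExp i) 1)) = wordFactor K A i l := by
        rw [← Polynomial.coe_evalRingHom, map_list_prod, List.map_map, wordFactor]
        congr 1
        refine List.map_congr_left fun j _ => ?_
        simp only [Function.comp_apply, Polynomial.coe_evalRingHom]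
        split_ifs
        · rw [Polynomial.eval_add, Polynomial.eval_mul, Polynomial.eval_one, Polynomial.eval_C,
            Polynomial.eval_X, ← HahnSeries.single_neg, HahnSeries.single_mul_single, mul_one,
            HahnSeries.single_neg, ← sub_eq_add_neg, ← sub_eq_add_neg]
        · rw [Polynomial.eval_one]
      rw [List.toFinset_cons, plethAddInv_insert (by rwa [List.mem_toFinset]), wordCross, ← h1]
      simp only [Φ, Polynomial.eval_mul, Polynomial.eval_C]
      ring
    -- The tail does not involve z_i, so the induction hypothesis needs exponent 0 there; `wordOp`
    -- on the tail does not see this change.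
    have ih' := ih hl (Function.update c i 0)
      (fun j hj hjA => by
        rw [Function.update_of_ne (by rintro rfl; exact hil hj)]
        exact hA j (List.mem_cons_of_mem _ hj) hjA)
      (fun j hj => by
        by_cases hji : j = i
        · subst hji; rw [Function.update_self]
        · rw [Function.update_of_ne hji]
          exact hc j (by rw [List.mem_cons]; tauto))
    rw [← wordOp_congr A l (c := c) (fun j hj => by
      rw [Function.update_of_ne (by rintro rfl; exact hil hj)])] at ih'
    have hO : wordOmega K A (i :: l) =
        (if i ∈ A then OmegaNeg K (zExp i) (zExp_pos i) else 1) * wordOmega K A l := by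
      rw [wordOmega, List.map_cons, List.prod_cons]; rfl
    rw [wordOp_cons, hO, ih']
    split_ifs with hiA
    · have h0 := hA i List.mem_cons_self hiA
      rw [← coeff_OmegaNeg_mul_eval_inv hΦ hF c (c i).toNat (by omega), hE]
      congr 1
      ring
    · rw [← coeff_eval_inv hΦ hF c, hE, one_mul]

end Words

/-! ### Products over pairs of variables -/

theorem prod_Ioi_comm {R : Type*} [CommMonoid R] {n : ℕ} (f : Fin n → Fin n → R) :
    ∏ i, ∏ j ∈ Finset.Ioi i, f i j = ∏ j, ∏ i ∈ Finset.Iio j, f i j :=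
  Finset.prod_comm' fun i j => by simp

/-- The Vandermonde determinant in Laurent monomials. -/
theorem det_inv_pow_mul_pow {R : Type*} [CommRing R] {n : ℕ} (u w : Fin n → R)
    (h : ∀ i, w i * u i = 1) : Matrix.det (Matrix.of fun i j : Fin n => w i ^ (i : ℕ) *
      u i ^ (j : ℕ)) = ∏ i, ∏ j ∈ Finset.Ioi i, (1 - w j * u i) := by
  have h1 : (Matrix.of fun i j : Fin n => w i ^ (i : ℕ) * u i ^ (j : ℕ)) =
      Matrix.of fun i j => w i ^ (i : ℕ) * Matrix.vandermonde u i j := rfl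
  -- The row scalars provide one factor w_j for each pair i < j, and w_j (u_j - u_i) = 1 - w_j u_i.
  have h2 : ∏ i, w i ^ (i : ℕ) = ∏ i : Fin n, ∏ j ∈ Finset.Ioi i, w j := by
    rw [prod_Ioi_comm]
    exact Finset.prod_congr rfl fun j _ => by rw [Finset.prod_const, Fin.card_Iio]
  rw [h1, Matrix.det_mul_column, Matrix.det_vandermonde, h2, ← Finset.prod_mul_distrib]
  refine Finset.prod_congr rfl fun i _ => ?_
  rw [← Finset.prod_mul_distrib]
  exact Finset.prod_congr rfl fun j _ => by rw [mul_sub, h]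

/-! ### Shuffles: the contribution of a single subset -/

section Core

attribute [local instance] symFnRing symFnNeg symFnSub

variable {K : Type*} [Field K] [CharZero K] {m : ℕ}

theorem prod_single {ι Γ R : Type*} [AddCommGroup Γ] [PartialOrder Γ] [IsOrderedAddMonoid Γ]
    [CommRing R] (s : Finset ι) (g : ι → Γ) (r : ι → R) :
    ∏ x ∈ s, HahnSeries.single (g x) (r x) =
      HahnSeries.single (∑ x ∈ s, g x) (∏ x ∈ s, r x) := by
  classical
  induction s using Finset.induction_on with
  | empty => rfl
  | insert x s hx ih =>
    rw [Finset.prod_insert hx, ih, HahnSeries.single_mul_single, Finset.sum_insert hx,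
      Finset.prod_insert hx]

omit [CharZero K] in
theorem wordFactor_append (A : Finset (Fin m)) (i : Fin m) (l₁ l₂ : List (Fin m))
    (h : ∀ j ∈ l₁, j ∉ A) : wordFactor K A i (l₁ ++ l₂) = wordFactor K A i l₂ := by
  rw [wordFactor, wordFactor, List.map_append, List.prod_append]
  have : (l₁.map fun j => if j ∈ A then 1 - HahnSeries.single (zExp j - zExp i) (1 : SymFn K)
      else 1).prod = 1 := by
    refine List.prod_eq_one fun x hx => ?_
    obtain ⟨j, hj, rfl⟩ := List.mem_map.1 hx
    rw [if_neg (h j hj)]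
  rw [this, one_mul]

-- Letters outside A carry no Ω, so they cost nothing when passed; each of them still passes every
-- letter of the second word.
omit [CharZero K] in
theorem wordCross_append (A : Finset (Fin m)) (l₁ l₂ : List (Fin m)) (h : ∀ j ∈ l₁, j ∉ A) :
    wordCross K A (l₁ ++ l₂) =
      (l₁.map fun i => wordFactor K A i l₂).prod * wordCross K A l₂ := by
  induction l₁ with
  | nil => rw [List.nil_append, List.map_nil, List.prod_nil, one_mul]
  | cons i l ih =>
    have h' : ∀ j ∈ l, j ∉ A := fun j hj => h j (List.mem_cons_of_mem _ hj)
    rw [List.cons_append, wordCross, ih h', wordFactor_append A i l l₂ h', List.map_cons,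
      List.prod_cons, mul_assoc]

omit [CharZero K] in
theorem wordFactor_ofFn (A : Finset (Fin m)) (i : Fin m) {k : ℕ} (a : Fin k → Fin m)
    (ha : ∀ j, a j ∈ A) : wordFactor K A i (List.ofFn a) =
      ∏ j, (1 - HahnSeries.single (zExp (a j) - zExp i) 1) := by
  rw [wordFactor, List.map_ofFn, List.prod_ofFn]
  exact Finset.prod_congr rfl fun j _ => by rw [Function.comp_apply, if_pos (ha j)]

omit [CharZero K] in
theorem wordCross_ofFn (A : Finset (Fin m)) {k : ℕ} (a : Fin k → Fin m) (ha : ∀ j, a j ∈ A) :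
    wordCross K A (List.ofFn a) =
      ∏ i, ∏ j ∈ Finset.Ioi i, (1 - HahnSeries.single (zExp (a j) - zExp (a i)) 1) := by
  induction k with
  | zero => simp [wordCross]
  | succ k ih =>
    rw [List.ofFn_succ, wordCross, wordFactor_ofFn A _ _ fun j => ha _, ih _ fun j => ha _,
      Fin.prod_univ_succ, Fin.prod_Ioi_zero]
    congr 1
    refine Finset.prod_congr rfl fun i _ => ?_
    rw [Fin.prod_Ioi_succ]

theorem vertexOp_smul (a : ℕ) (r : K) (P : SymFn K) : vertexOp a (r • P) = r • vertexOp a P := by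
  have h1 : (translate K P).natDegree < (translate K P).natDegree + 1 := Nat.lt_succ_self _
  have h2 : (translate K (r • P)).natDegree < (translate K P).natDegree + 1 := by
    rw [map_smul]
    exact Nat.lt_succ_of_le (Polynomial.natDegree_smul_le _ _)
  rw [vertexOp_eq_sum a _ h1, vertexOp_eq_sum a _ h2, Finset.smul_sum]
  refine Finset.sum_congr rfl fun n _ => ?_
  rw [map_smul, Polynomial.coeff_smul, mul_smul_comm]

theorem STilde_natCast_smul (a : ℕ) (r : K) (P : SymFn K) :
    STilde (a : ℤ) (r • P) = (r * (-1) ^ a) • vertexOp a P := by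
  rw [STilde_natCast, vertexOp_smul, mul_comm r, mul_smul, Algebra.smul_def ((-1) ^ a : K),
    map_pow, map_neg, map_one]

theorem foldr_STilde (A : Finset (Fin m)) (c : Fin m → ℤ) (f : Fin m → ℕ) (l : List (Fin m))
    (hl : ∀ i ∈ l, i ∈ A) (hf : ∀ i ∈ l, c i = f i) (P : SymFn K) :
    (l.map f).foldr (fun (a : ℕ) Q => STilde (a : ℤ) Q) P =
      ((-1 : K) ^ (l.map f).sum) • wordOp A c l P := by
  induction l with
  | nil => simp [wordOp_nil]
  | cons i l ih =>
    rw [List.map_cons, List.foldr_cons, ih (fun j hj => hl j (List.mem_cons_of_mem _ hj))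
      (fun j hj => hf j (List.mem_cons_of_mem _ hj)), STilde_natCast_smul, wordOp_cons,
      if_pos (hl i List.mem_cons_self), hf i List.mem_cons_self, List.sum_cons, Int.toNat_natCast,
      ← pow_add, add_comm]

theorem wordOp_append_of_notMem (A : Finset (Fin m)) (c : Fin m → ℤ) (l₁ l₂ : List (Fin m))
    (h : ∀ j ∈ l₁, j ∉ A) (P : SymFn K) : wordOp A c (l₁ ++ l₂) P =
      skew (l₁.map fun i => hInt K (-(c i))).prod (wordOp A c l₂ P) := by
  induction l₁ with
  | nil => rw [List.nil_append, List.map_nil, List.prod_nil, skew_one]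
  | cons i l ih =>
    rw [List.cons_append, wordOp_cons, if_neg (h i List.mem_cons_self),
      ih fun j hj => h j (List.mem_cons_of_mem _ hj), List.map_cons, List.prod_cons, skew_mul]

/-- An enumeration of the variables by two complementary subsets, the first in increasing and the
second in decreasing order. -/
structure Shuffle (m k n : ℕ) where
  /-- The first subset. -/
  a : Fin k → Fin m
  /-- The second subset. -/
  b : Fin n → Fin m
  a_mono : StrictMono a
  -- The decreasing order makes #{i : a_i < b_r} weakly decreasing in r, as the row lengths of a
  -- partition must be.
  b_anti : StrictAnti b
  ne : ∀ i r, a i ≠ b r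
  cover : ∀ x, (∃ i, a i = x) ∨ ∃ r, b r = x

namespace Shuffle

variable {k n : ℕ} (w : Shuffle m k n)

/-- The first subset as a finset. -/
def A : Finset (Fin m) := Finset.univ.image w.a

theorem a_mem (i : Fin k) : w.a i ∈ w.A := Finset.mem_image_of_mem _ (Finset.mem_univ _)

theorem b_notMem (r : Fin n) : w.b r ∉ w.A := by
  intro h
  obtain ⟨i, -, hi⟩ := Finset.mem_image.1 h
  exact w.ne i r hi

theorem bijective : Function.Bijective (Sum.elim w.a w.b) := by
  constructor
  · rintro (i | r) (j | s) h
    · rw [w.a_mono.injective h]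
    · exact absurd h (w.ne i s)
    · exact absurd h.symm (w.ne j r)
    · rw [w.b_anti.injective h]
  · intro x
    rcases w.cover x with ⟨i, hi⟩ | ⟨r, hr⟩
    · exact ⟨Sum.inl i, hi⟩
    · exact ⟨Sum.inr r, hr⟩

theorem prod_eq {R : Type*} [CommMonoid R] (f : Fin m → R) :
    ∏ x, f x = (∏ i, f (w.a i)) * ∏ r, f (w.b r) := by
  rw [← (Equiv.ofBijective _ w.bijective).prod_comp, Fintype.prod_sum_type]
  rfl

/-- The pairs `(r, i)` with `a i < b r`. -/
def inv : Finset (Fin n × Fin k) := Finset.univ.filter fun p => w.a p.2 < w.b p.1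

/-- The exponent of the product of all `z_{b r} / z_{a i}` with `a i < b r`. -/
def invExp : Fin m → ℤ := ∑ p ∈ w.inv, (zExp (w.b p.1) - zExp (w.a p.2))

theorem invExp_a (i : Fin k) :
    w.invExp (w.a i) = -((Finset.univ.filter fun r => w.a i < w.b r).card : ℤ) := by
  classical
  have h : ∀ p ∈ w.inv, (zExp (w.b p.1) - zExp (w.a p.2)) (w.a i) =
      -(if i = p.2 then (1 : ℤ) else 0) := by
    intro p _
    rw [Pi.sub_apply, zExp, zExp, Pi.single_eq_of_ne (w.ne i p.1), zero_sub, Pi.single_apply]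
    simp only [w.a_mono.injective.eq_iff]
  rw [invExp, Finset.sum_apply, Finset.sum_congr rfl h, Finset.sum_neg_distrib, ← Finset.sum_filter,
    Finset.sum_const, nsmul_eq_mul, mul_one]
  congr 2
  refine Finset.card_bij (fun p _ => p.1) ?_ ?_ ?_
  · rintro ⟨r, j⟩ hp
    simp only [inv, Finset.mem_filter, Finset.mem_univ, true_and] at hp ⊢
    rw [hp.2]; exact hp.1
  · rintro ⟨r, j⟩ hp ⟨s, j'⟩ hp' h
    simp only [Finset.mem_filter] at hp hp' h
    rw [h, ← hp.2, ← hp'.2]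
  · intro r hr
    exact ⟨(r, i), by simpa [inv] using hr, rfl⟩

theorem invExp_b (r : Fin n) :
    w.invExp (w.b r) = ((Finset.univ.filter fun i => w.a i < w.b r).card : ℤ) := by
  classical
  have h : ∀ p ∈ w.inv, (zExp (w.b p.1) - zExp (w.a p.2)) (w.b r) =
      (if r = p.1 then (1 : ℤ) else 0) := by
    intro p _
    rw [Pi.sub_apply, zExp, zExp, Pi.single_eq_of_ne (w.ne p.2 r).symm, sub_zero, Pi.single_apply]
    simp only [w.b_anti.injective.eq_iff]
  rw [invExp, Finset.sum_apply, Finset.sum_congr rfl h, ← Finset.sum_filter,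
    Finset.sum_const, nsmul_eq_mul, mul_one]
  congr 1
  refine Finset.card_bij (fun p _ => p.2) ?_ ?_ ?_
  · rintro ⟨s, j⟩ hp
    simp only [inv, Finset.mem_filter, Finset.mem_univ, true_and] at hp ⊢
    rw [hp.2]; exact hp.1
  · rintro ⟨s, j⟩ hp ⟨s', j'⟩ hp' h
    simp only [Finset.mem_filter] at hp hp' h
    rw [h, ← hp.2, ← hp'.2]
  · intro i hi
    exact ⟨(r, i), by simpa [inv] using hi, rfl⟩

/-- The word `b_0 b_1 ⋯ a_0 a_1 ⋯`. -/
def word : List (Fin m) := List.ofFn w.b ++ List.ofFn w.a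

theorem word_nodup : w.word.Nodup := by
  refine List.Nodup.append (List.nodup_ofFn.2 w.b_anti.injective)
    (List.nodup_ofFn.2 w.a_mono.injective) ?_
  intro x hb ha
  obtain ⟨r, rfl⟩ := (List.mem_ofFn' _ _).1 hb
  obtain ⟨i, hi⟩ := (List.mem_ofFn' _ _).1 ha
  exact w.ne i r hi

theorem mem_word (x : Fin m) : x ∈ w.word := by
  rw [word, List.mem_append, List.mem_ofFn', List.mem_ofFn']
  exact (w.cover x).symm

theorem toFinset_word : w.word.toFinset = Finset.univ :=
  Finset.eq_univ_of_forall fun x => List.mem_toFinset.2 (w.mem_word x)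

theorem wordOmega_word : wordOmega K w.A w.word =
    ∏ x ∈ w.A, OmegaNeg K (zExp x) (zExp_pos x) := by
  rw [wordOmega, ← List.prod_toFinset _ w.word_nodup, toFinset_word, Finset.prod_ite_mem,
    Finset.univ_inter]

omit [CharZero K] in
theorem wordCross_word : wordCross K w.A w.word =
    (∏ r, ∏ i, (1 - HahnSeries.single (zExp (w.a i) - zExp (w.b r)) 1)) *
      ∏ i, ∏ j ∈ Finset.Ioi i, (1 - HahnSeries.single (zExp (w.a j) - zExp (w.a i)) 1) := by
  rw [word, wordCross_append, wordCross_ofFn _ _ w.a_mem, List.map_ofFn, List.prod_ofFn]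
  · congr 1
    exact Finset.prod_congr rfl fun r _ => wordFactor_ofFn _ _ _ w.a_mem
  · intro j hj
    obtain ⟨r, rfl⟩ := (List.mem_ofFn' _ _).1 hj
    exact w.b_notMem r

/-- A pair of variables is mixed, or lies in the first subset, or in the second; in the last case r
< s means b_s < b_r, hence the reversed arguments. -/
theorem prod_pairs {R : Type*} [CommMonoid R] (f : Fin m → Fin m → R) :
    ∏ x, ∏ y ∈ Finset.Ioi x, f x y =
      (∏ r, ∏ i, if w.a i < w.b r then f (w.a i) (w.b r) else f (w.b r) (w.a i)) *
      (∏ i, ∏ j ∈ Finset.Ioi i, f (w.a i) (w.a j)) *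
      ∏ r, ∏ s ∈ Finset.Ioi r, f (w.b s) (w.b r) := by
  classical
  have h0 : ∀ x, ∏ y ∈ Finset.Ioi x, f x y = ∏ y, if x < y then f x y else 1 := by
    intro x
    rw [← Finset.prod_filter]
    exact Finset.prod_congr (by ext; simp) fun _ _ => rfl
  have ha : ∀ i, ∏ j, (if w.a i < w.a j then f (w.a i) (w.a j) else 1) =
      ∏ j ∈ Finset.Ioi i, f (w.a i) (w.a j) := by
    intro i
    simp only [w.a_mono.lt_iff_lt]
    rw [← Finset.prod_filter]
    exact Finset.prod_congr (by ext; simp) fun _ _ => rfl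
  have hb : ∀ r, ∏ s, (if w.b r < w.b s then f (w.b r) (w.b s) else 1) =
      ∏ s ∈ Finset.Iio r, f (w.b r) (w.b s) := by
    intro i
    simp only [w.b_anti.lt_iff_gt]
    rw [← Finset.prod_filter]
    exact Finset.prod_congr (by ext; simp) fun _ _ => rfl
  have hc : (∏ r, ∏ i, if w.a i < w.b r then f (w.a i) (w.b r) else f (w.b r) (w.a i)) =
      (∏ i, ∏ r, if w.a i < w.b r then f (w.a i) (w.b r) else 1) *
        ∏ r, ∏ i, if w.b r < w.a i then f (w.b r) (w.a i) else 1 := by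
    rw [Finset.prod_comm (s := (Finset.univ : Finset (Fin k))), ← Finset.prod_mul_distrib]
    refine Finset.prod_congr rfl fun r _ => ?_
    rw [← Finset.prod_mul_distrib]
    refine Finset.prod_congr rfl fun i _ => ?_
    rcases lt_or_gt_of_ne (w.ne i r) with h | h
    · rw [if_pos h, if_pos h, if_neg h.le.not_gt, mul_one]
    · rw [if_neg h.le.not_gt, if_neg h.le.not_gt, if_pos h, one_mul]
  rw [Finset.prod_congr rfl fun x _ => h0 x, w.prod_eq]
  simp only [w.prod_eq, Finset.prod_mul_distrib]
  rw [hc, prod_Ioi_comm (fun r s => f (w.b s) (w.b r))]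
  simp only [ha, hb]
  ac_rfl

-- Each mixed pair with a_i < b_r is reoriented by 1 - z_b/z_a = -(z_b/z_a)(1 - z_a/z_b); the
-- prefactors multiply to the signed monomial with exponent `invExp`.
omit [CharZero K] in
theorem prod_pairs_single :
    ∏ x, ∏ y ∈ Finset.Ioi x, (1 - HahnSeries.single (zExp y - zExp x) (1 : SymFn K)) =
      HahnSeries.single w.invExp ((-1) ^ w.inv.card) * (wordCross K w.A w.word *
        ∏ r, ∏ s ∈ Finset.Ioi r, (1 - HahnSeries.single (zExp (w.b r) - zExp (w.b s)) 1)) := by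
  classical
  have h1 : ∀ r i, (if w.a i < w.b r then
        1 - HahnSeries.single (zExp (w.b r) - zExp (w.a i)) (1 : SymFn K) else
        1 - HahnSeries.single (zExp (w.a i) - zExp (w.b r)) 1) =
      (if w.a i < w.b r then HahnSeries.single (zExp (w.b r) - zExp (w.a i)) (-1) else 1) *
        (1 - HahnSeries.single (zExp (w.a i) - zExp (w.b r)) (1 : SymFn K)) := by
    intro r i
    split_ifs
    · rw [mul_sub, mul_one, HahnSeries.single_mul_single, mul_one, sub_add_sub_cancel, sub_self,
        HahnSeries.single_neg, HahnSeries.single_neg, HahnSeries.single_zero_one,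
        sub_neg_eq_add, neg_add_eq_sub]
    · rw [one_mul]
  have h2 : ∏ r, ∏ i, (if w.a i < w.b r then
      HahnSeries.single (zExp (w.b r) - zExp (w.a i)) (-1 : SymFn K) else 1) =
        HahnSeries.single w.invExp ((-1) ^ w.inv.card) := by
    rw [← Fintype.prod_prod_type', ← Finset.prod_filter, prod_single, Finset.prod_const]
    rfl
  rw [w.prod_pairs]
  simp only [h1, Finset.prod_mul_distrib]
  rw [h2, wordCross_word]
  ring

/-- The summands become the column lengths of a ribbon's partition, so this is the exponent of the
total sign of the operators S̃. -/
theorem sum_card_inv :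
    ∑ i, (1 + (Finset.univ.filter fun r => w.a i < w.b r).card) = k + w.inv.card := by
  classical
  rw [Finset.sum_add_distrib, Finset.sum_const, Finset.card_univ, Fintype.card_fin, smul_eq_mul,
    mul_one, inv]
  congr 1
  simp only [Finset.card_filter]
  rw [← Fintype.sum_prod_type_right' (f := fun r i => if w.a i < w.b r then 1 else 0)]

/-- The shift of exponents in the expansion of the Jacobi–Trudi determinant. -/
def shift (σ : Equiv.Perm (Fin n)) : Fin m → ℤ :=
  ∑ r : Fin n, (((r : ℕ) : ℤ) - ((σ r : ℕ) : ℤ)) • zExp (w.b r)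

theorem shift_a (σ : Equiv.Perm (Fin n)) (i : Fin k) : w.shift σ (w.a i) = 0 := by
  rw [shift, Finset.sum_apply]
  refine Finset.sum_eq_zero fun r _ => ?_
  rw [Pi.smul_apply, zExp, Pi.single_eq_of_ne (w.ne i r), smul_zero]

theorem shift_b (σ : Equiv.Perm (Fin n)) (r : Fin n) :
    w.shift σ (w.b r) = ((r : ℕ) : ℤ) - ((σ r : ℕ) : ℤ) := by
  rw [shift, Finset.sum_apply, Finset.sum_eq_single r]
  · rw [Pi.smul_apply, zExp, Pi.single_eq_same, smul_eq_mul, mul_one]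
  · intro s _ hs
    rw [Pi.smul_apply, zExp, Pi.single_eq_of_ne fun h => hs (w.b_anti.injective h).symm, smul_zero]
  · exact fun h => absurd (Finset.mem_univ r) h

-- The Leibniz expansion of the Laurent Vandermonde determinant in the variables z_{b_r}: the index
-- shifts of Jacobi–Trudi produce exactly the factors for pairs within the second subset.
omit [CharZero K] in
theorem sum_sign_single_shift :
    ∑ σ : Equiv.Perm (Fin n), HahnSeries.single (-w.shift σ) ((Equiv.Perm.sign σ : ℤ) : SymFn K) =
      ∏ r, ∏ s ∈ Finset.Ioi r, (1 - HahnSeries.single (zExp (w.b r) - zExp (w.b s)) 1) := by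
  have h := det_inv_pow_mul_pow (R := HahnSeries (Fin m → ℤ) (SymFn K))
    (fun r => HahnSeries.single (zExp (w.b r)) 1) (fun r => HahnSeries.single (-zExp (w.b r)) 1)
    (fun r => by rw [HahnSeries.single_mul_single, neg_add_cancel, one_mul]; rfl)
  rw [← Matrix.det_transpose, Matrix.det_apply'] at h
  refine Eq.trans (Finset.sum_congr rfl fun σ _ => ?_) (h.trans ?_)
  · have h1 : ∀ r, (Matrix.of fun i j : Fin n =>
        (HahnSeries.single (-zExp (w.b i)) (1 : SymFn K)) ^ (i : ℕ) *
          (HahnSeries.single (zExp (w.b i)) 1) ^ (j : ℕ)).transpose (σ r) r =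
        HahnSeries.single (-((((r : ℕ) : ℤ) - ((σ r : ℕ) : ℤ)) • zExp (w.b r))) 1 := by
      intro r
      rw [Matrix.transpose_apply, Matrix.of_apply, HahnSeries.single_pow, HahnSeries.single_pow,
        HahnSeries.single_mul_single, one_pow, one_pow, one_mul, sub_smul, natCast_zsmul,
        natCast_zsmul, smul_neg, neg_sub, neg_add_eq_sub]
    rw [Finset.prod_congr rfl fun r _ => h1 r, prod_single, Finset.prod_const_one,
      Finset.sum_neg_distrib, ← HahnSeries.single_zero_intCast, HahnSeries.single_mul_single,
      zero_add, mul_one]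
    rfl
  · refine Finset.prod_congr rfl fun r _ => Finset.prod_congr rfl fun s _ => ?_
    rw [HahnSeries.single_mul_single, neg_add_eq_sub, one_mul]

/-- The coefficient of `z_1 ⋯ z_m` in the term of the product formula indexed by the first
subset. -/
theorem skew_det_foldr_STilde (P : SymFn K) :
    skew (Matrix.det (Matrix.of fun r s : Fin n => hInt K
        (((Finset.univ.filter fun i => w.a i < w.b r).card : ℤ) - 1 - ((r : ℕ) : ℤ)
          + ((s : ℕ) : ℤ))))
      ((List.ofFn fun i => 1 + (Finset.univ.filter fun r => w.a i < w.b r).card).foldr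
        (fun (a : ℕ) Q => STilde (a : ℤ) Q) P) =
    (-1 : K) ^ k • (plethAddInv K Finset.univ P * (∏ x ∈ w.A, OmegaNeg K (zExp x) (zExp_pos x)) *
      ∏ x, ∏ y ∈ Finset.Ioi x, (1 - HahnSeries.single (zExp y - zExp x) 1)).coeff
        (fun _ => 1) := by
  classical
  -- The exponent still to be extracted once the monomial of the inversions has been removed from
  -- z_0 ⋯ z_{m-1}.
  set c : Fin m → ℤ := (fun _ => 1) - w.invExp with hc
  have hca : ∀ i, c (w.a i) = ((1 + (Finset.univ.filter fun r => w.a i < w.b r).card : ℕ) : ℤ) := by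
    intro i
    rw [hc, Pi.sub_apply, invExp_a, sub_neg_eq_add]
    push_cast
    rfl
  have hcb : ∀ r, c (w.b r) = 1 - ((Finset.univ.filter fun i => w.a i < w.b r).card : ℤ) := by
    intro r
    rw [hc, Pi.sub_apply, invExp_b]
  set G := plethAddInv K Finset.univ P * (∏ x ∈ w.A, OmegaNeg K (zExp x) (zExp_pos x)) with hG
  have hfold : (List.ofFn fun i => 1 + (Finset.univ.filter fun r => w.a i < w.b r).card).foldr
      (fun (a : ℕ) Q => STilde (a : ℤ) Q) P =
        ((-1 : K) ^ (k + w.inv.card)) • wordOp w.A c (List.ofFn w.a) P := by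
    have h := foldr_STilde (K := K) w.A c (fun x => (c x).toNat) (List.ofFn w.a)
      (fun x hx => by
        obtain ⟨i, rfl⟩ := (List.mem_ofFn' _ _).1 hx
        exact w.a_mem i)
      (fun x hx => by
        obtain ⟨i, rfl⟩ := (List.mem_ofFn' _ _).1 hx
        rw [hca, Int.toNat_natCast]) P
    rw [List.map_ofFn, List.sum_ofFn] at h
    have h2 : (fun x => (c x).toNat) ∘ w.a =
        fun i => 1 + (Finset.univ.filter fun r => w.a i < w.b r).card :=
      funext fun i => by rw [Function.comp_apply, hca, Int.toNat_natCast]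
    rw [h2, sum_card_inv] at h
    exact h
  -- One Leibniz term is the operator of the whole word: -(c + shift) at b_r is the index of h in
  -- row r, column σ r.
  have hterm : ∀ σ : Equiv.Perm (Fin n), skew (∏ r, hInt K
      (((Finset.univ.filter fun i => w.a i < w.b r).card : ℤ) - 1 - ((r : ℕ) : ℤ)
          + ((σ r : ℕ) : ℤ))) (wordOp w.A c (List.ofFn w.a) P) =
        (G * wordCross K w.A w.word).coeff (c + w.shift σ) := by
    intro σ
    have h1 : wordOp w.A (c + w.shift σ) w.word P =
        (G * wordCross K w.A w.word).coeff (c + w.shift σ) := by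
      rw [wordOp_eq_coeff w.A P w.word w.word_nodup, toFinset_word, wordOmega_word]
      · intro x _ hx
        obtain ⟨i, -, rfl⟩ := Finset.mem_image.1 hx
        rw [Pi.add_apply, hca, shift_a, add_zero]
        exact Int.natCast_nonneg _
      · exact fun x hx => absurd (w.mem_word x) hx
    rw [← h1, word, wordOp_append_of_notMem, List.map_ofFn, List.prod_ofFn]
    · refine congrArg₂ skew ?_ ?_
      · refine Finset.prod_congr rfl fun r _ => ?_
        rw [Function.comp_apply, Pi.add_apply, hcb, shift_b]
        congr 1
        ring
      · refine wordOp_congr _ _ (fun x hx => ?_) P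
        obtain ⟨i, rfl⟩ := (List.mem_ofFn' _ _).1 hx
        rw [Pi.add_apply, shift_a, add_zero]
    · intro x hx
      obtain ⟨r, rfl⟩ := (List.mem_ofFn' _ _).1 hx
      exact w.b_notMem r
  rw [hfold, skew_smul, ← Matrix.det_transpose, Matrix.det_apply', ← skewHom_apply, map_sum,
    LinearMap.sum_apply]
  have hsum : ∑ σ : Equiv.Perm (Fin n), skewHom K (((Equiv.Perm.sign σ : ℤ) : SymFn K) *
      ∏ r, (Matrix.of fun r s : Fin n => hInt K
        (((Finset.univ.filter fun i => w.a i < w.b r).card : ℤ) - 1 - ((r : ℕ) : ℤ)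
          + ((s : ℕ) : ℤ))).transpose (σ r) r) (wordOp w.A c (List.ofFn w.a) P) =
      (G * wordCross K w.A w.word * ∏ r, ∏ s ∈ Finset.Ioi r,
        (1 - HahnSeries.single (zExp (w.b r) - zExp (w.b s)) 1)).coeff c := by
    rw [← sum_sign_single_shift, Finset.mul_sum, HahnSeries.coeff_sum]
    refine Finset.sum_congr rfl fun σ _ => ?_
    have hz : ((Equiv.Perm.sign σ : ℤ) : SymFn K) =
        algebraMap K (SymFn K) ((Equiv.Perm.sign σ : ℤ) : K) := (map_intCast _ _).symm
    rw [HahnSeries.coeff_mul_single, sub_neg_eq_add, ← hterm σ, hz, ← Algebra.smul_def,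
      skewHom_apply, smul_skew, Algebra.smul_def, mul_comm]
    rfl
  -- The sign (-1)^|inv| of the column lengths matches that of the reorientations, so only (-1)^k
  -- remains.
  rw [hsum, prod_pairs_single, pow_add, mul_smul]
  congr 1
  have h3 : G * (HahnSeries.single w.invExp ((-1) ^ w.inv.card) * (wordCross K w.A w.word *
        ∏ r, ∏ s ∈ Finset.Ioi r, (1 - HahnSeries.single (zExp (w.b r) - zExp (w.b s)) 1))) =
      HahnSeries.single w.invExp ((-1) ^ w.inv.card) * (G * wordCross K w.A w.word *
        ∏ r, ∏ s ∈ Finset.Ioi r, (1 - HahnSeries.single (zExp (w.b r) - zExp (w.b s)) 1)) := by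
    ring
  rw [h3, HahnSeries.coeff_single_mul, Algebra.smul_def, map_pow, map_neg, map_one]

end Shuffle

end Core

/-! ### Ribbons and subsets -/

section Padding

attribute [local instance] symFnRing symFnNeg symFnSub

variable {K : Type*} [Field K] [CharZero K]

omit [CharZero K] in
/-- The Jacobi–Trudi determinant may be enlarged by empty rows. -/
theorem schur_eq_det (μ : YoungDiagram) (n : ℕ) (hn : μ.colLen 0 ≤ n) :
    schur K μ = Matrix.det (Matrix.of fun r s : Fin n =>
      hInt K ((μ.rowLen r : ℤ) - (r : ℤ) + (s : ℤ))) := by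
  induction n, hn using Nat.le_induction with
  | base => rfl
  | succ n hn ih =>
    have hrow : μ.rowLen n = 0 := by
      by_contra h
      have h1 := YoungDiagram.mem_iff_lt_colLen.1
        (YoungDiagram.mem_iff_lt_rowLen.2 (Nat.pos_of_ne_zero h))
      omega
    rw [ih, Matrix.det_succ_row _ (Fin.last n), Finset.sum_eq_single (Fin.last n)]
    · have h1 : (Matrix.of fun r s : Fin (n + 1) =>
          hInt K ((μ.rowLen r : ℤ) - ((r : ℕ) : ℤ) + ((s : ℕ) : ℤ))) (Fin.last n) (Fin.last n) =
            1 := by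
        rw [Matrix.of_apply, Fin.val_last, hrow, hInt, if_pos (by simp)]
        simp [hsymm_zero]
      rw [h1, ← two_mul, pow_mul, neg_one_sq, one_pow, one_mul, one_mul]
      congr 1
      ext r s : 2
      simp
    · intro j _ hj
      have hlt : (j : ℕ) < n := Fin.val_lt_last hj
      have h1 : (Matrix.of fun r s : Fin (n + 1) =>
          hInt K ((μ.rowLen r : ℤ) - ((r : ℕ) : ℤ) + ((s : ℕ) : ℤ))) (Fin.last n) j = 0 := by
        rw [Matrix.of_apply, Fin.val_last, hrow, hInt, if_neg (by push_cast; omega)]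
      rw [h1, mul_zero, zero_mul]
    · exact fun h => absurd (Finset.mem_univ _) h

end Padding

theorem mem_rc {μ : YoungDiagram} {r c : ℕ} : (r, c) ∈ rc μ ↔ (r + 1, c + 1) ∈ μ := by
  change (r, c) ∈ μ.cells.filter (fun c => (c.1 + 1, c.2 + 1) ∈ μ) ↔ _
  rw [Finset.mem_filter, YoungDiagram.mem_cells]
  exact ⟨fun h => h.2, fun h => ⟨μ.up_left_mem (Nat.le_succ r) (Nat.le_succ c) h, h⟩⟩

theorem rowLen_rc (μ : YoungDiagram) (r : ℕ) : (rc μ).rowLen r = μ.rowLen (r + 1) - 1 := by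
  refine eq_of_forall_lt_iff fun c => ?_
  rw [← YoungDiagram.mem_iff_lt_rowLen, mem_rc, YoungDiagram.mem_iff_lt_rowLen]
  omega

theorem colLen_rc (μ : YoungDiagram) (c : ℕ) : (rc μ).colLen c = μ.colLen (c + 1) - 1 := by
  refine eq_of_forall_lt_iff fun r => ?_
  rw [← YoungDiagram.mem_iff_lt_colLen, mem_rc, YoungDiagram.mem_iff_lt_colLen]
  omega

theorem lt_colLen_iff_lt_rowLen {μ : YoungDiagram} {r c : ℕ} :
    r < μ.colLen c ↔ c < μ.rowLen r := by
  rw [← YoungDiagram.mem_iff_lt_colLen, YoungDiagram.mem_iff_lt_rowLen]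

theorem rowLens_transpose (μ : YoungDiagram) :
    μ.transpose.rowLens = List.ofFn fun i : Fin (μ.rowLen 0) => μ.colLen i := by
  rw [YoungDiagram.rowLens, YoungDiagram.colLen_transpose, List.ofFn_eq_map,
    ← List.map_coe_finRange_eq_range, List.map_map]
  exact List.map_congr_left fun i _ => by
    rw [Function.comp_apply, YoungDiagram.rowLen_transpose]

namespace Ribbon

variable {m : ℕ} (R : Ribbon m)

theorem rowLen_pos : 0 < R.1.rowLen 0 := by
  obtain ⟨c, hc⟩ : R.1.cells.Nonempty := by
    rw [Finset.nonempty_iff_ne_empty]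
    exact fun h => R.2.1 (YoungDiagram.ext h)
  have h : (c.1, c.2) ∈ R.1 := hc
  exact YoungDiagram.mem_iff_lt_rowLen.1
    (R.1.up_left_mem (Nat.zero_le _) (Nat.zero_le _) h : (0, 0) ∈ R.1)

theorem colLen_pos : 0 < R.1.colLen 0 := lt_colLen_iff_lt_rowLen.2 R.rowLen_pos

theorem size_eq : R.1.rowLen 0 + (R.1.colLen 0 - 1) = m := by
  have := R.2.2
  have := R.colLen_pos
  omega

theorem colLen_pos_of_lt {i : ℕ} (hi : i < R.1.rowLen 0) : 0 < R.1.colLen i :=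
  lt_colLen_iff_lt_rowLen.2 hi

theorem colLen_le (i : ℕ) : R.1.colLen i ≤ R.1.colLen 0 := R.1.colLen_anti 0 i (Nat.zero_le _)

theorem rowLen_le (i : ℕ) : R.1.rowLen i ≤ R.1.rowLen 0 := R.1.rowLen_anti 0 i (Nat.zero_le _)

/-- The shuffle of a ribbon: the steps into a new column and the steps down. -/
def shuffle : Shuffle m (R.1.rowLen 0) (R.1.colLen 0 - 1) :=
  -- In zero-based reading order the left value is the position of the top cell of column i, the
  -- right one that of the cell of row r just below the last cell of row r + 1. Whether column i
  -- reaches row r + 1 decides which is strictly larger.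
  have hne : ∀ (i : Fin (R.1.rowLen 0)) (r : Fin (R.1.colLen 0 - 1)),
      (i : ℕ) + R.1.colLen 0 - R.1.colLen i ≠ R.1.rowLen (r + 1) + R.1.colLen 0 - r - 2 := by
    intro i r h
    have h1 := R.colLen_le i
    have h2 := r.isLt
    have h3 : (r : ℕ) + 1 < R.1.colLen i ↔ (i : ℕ) < R.1.rowLen (r + 1) := lt_colLen_iff_lt_rowLen
    omega
  have ha : StrictMono fun i : Fin (R.1.rowLen 0) =>
      (⟨i + R.1.colLen 0 - R.1.colLen i, by
        have := R.size_eq; have := R.colLen_pos_of_lt i.isLt; have := i.isLt; omega⟩ : Fin m) := by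
    intro i j hij
    have h1 := R.colLen_le i
    have h2 := R.1.colLen_anti i j (le_of_lt hij)
    have h3 : (i : ℕ) < j := hij
    rw [Fin.lt_def]
    simp only
    omega
  have hb : StrictAnti fun r : Fin (R.1.colLen 0 - 1) =>
      (⟨R.1.rowLen (r + 1) + R.1.colLen 0 - r - 2, by
        have := R.size_eq; have := R.rowLen_le (r + 1); have := r.isLt; omega⟩ : Fin m) := by
    intro r s hrs
    have h1 : (r : ℕ) < s := hrs
    have h2 := R.1.rowLen_anti (r + 1) (s + 1) (by omega)
    have h3 := s.isLt
    rw [Fin.lt_def]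
    simp only
    omega
  { a := _
    b := _
    a_mono := ha
    b_anti := hb
    ne := fun i r h => hne i r (congrArg Fin.val h)
    cover := by
      have hinj : Function.Injective (Sum.elim (fun i : Fin (R.1.rowLen 0) => _) fun r => _) :=
        Function.Injective.sumElim ha.injective hb.injective fun i r h =>
          hne i r (congrArg Fin.val h)
      -- Covering follows by counting, since λ_1 + (ℓ(λ) - 1) = m.
      have hsurj := ((Fintype.bijective_iff_injective_and_card _).2
        ⟨hinj, by
          rw [Fintype.card_sum, Fintype.card_fin, Fintype.card_fin, Fintype.card_fin,
            R.size_eq]⟩).2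
      intro x
      obtain ⟨i | r, h⟩ := hsurj x
      · exact Or.inl ⟨i, h⟩
      · exact Or.inr ⟨r, h⟩ }

theorem shuffle_a (i : Fin (R.1.rowLen 0)) :
    (R.shuffle.a i : ℕ) = i + R.1.colLen 0 - R.1.colLen i := rfl

theorem shuffle_b (r : Fin (R.1.colLen 0 - 1)) :
    (R.shuffle.b r : ℕ) = R.1.rowLen (r + 1) + R.1.colLen 0 - r - 2 := rfl

/-- Column i begins before the step down into row r exactly when row r + 1 reaches column i.
Counting in one index or the other yields the row and column lengths of λ. -/
theorem shuffle_lt_iff (i : Fin (R.1.rowLen 0)) (r : Fin (R.1.colLen 0 - 1)) :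
    R.shuffle.a i < R.shuffle.b r ↔ (i : ℕ) < R.1.rowLen (r + 1) := by
  have h1 := R.colLen_le i
  have h2 := r.isLt
  have h3 : (r : ℕ) + 1 < R.1.colLen i ↔ (i : ℕ) < R.1.rowLen (r + 1) := lt_colLen_iff_lt_rowLen
  rw [Fin.lt_def, shuffle_a, shuffle_b]
  omega

theorem card_filter_a_lt (r : Fin (R.1.colLen 0 - 1)) :
    (Finset.univ.filter fun i => R.shuffle.a i < R.shuffle.b r).card = R.1.rowLen (r + 1) := by
  simp only [shuffle_lt_iff]
  rw [Fin.card_filter_val_lt, min_eq_right (R.rowLen_le _)]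

theorem card_filter_lt_b (i : Fin (R.1.rowLen 0)) :
    1 + (Finset.univ.filter fun r => R.shuffle.a i < R.shuffle.b r).card = R.1.colLen i := by
  have h : ∀ r : Fin (R.1.colLen 0 - 1),
      R.shuffle.a i < R.shuffle.b r ↔ (r : ℕ) < R.1.colLen i - 1 := by
    intro r
    rw [shuffle_lt_iff, ← lt_colLen_iff_lt_rowLen]
    omega
  simp only [h]
  have h1 := R.colLen_le i
  have h2 := R.colLen_pos_of_lt i.isLt
  rw [Fin.card_filter_val_lt, min_eq_right (by omega)]
  omega

/-! ### Labels and descents -/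

theorem mem_cells_iff {r c : ℕ} : (r, c) ∈ R.cells ↔ (r, c) ∈ R.1 ∧ (r + 1, c + 1) ∉ R.1 := by
  rw [Ribbon.cells, Finset.mem_sdiff, YoungDiagram.mem_cells, YoungDiagram.mem_cells, mem_rc]

theorem lt_of_mem {r c : ℕ} (h : (r, c) ∈ R.1) : r < R.1.colLen 0 ∧ c < R.1.rowLen 0 :=
  ⟨(YoungDiagram.mem_iff_lt_colLen.1 h).trans_le (R.colLen_le c),
    (YoungDiagram.mem_iff_lt_rowLen.1 h).trans_le (R.rowLen_le r)⟩

/-- A ribbon contains no 2 × 2 square. In particular it has at most one cell on each diagonal, so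
that the content determines the cell. -/
theorem not_lt_lt {r c r' c' : ℕ} (h : (r, c) ∈ R.cells) (h' : (r', c') ∈ R.cells) :
    ¬ (r < r' ∧ c < c') := by
  rw [mem_cells_iff] at h h'
  exact fun hlt => h.2 (R.1.up_left_mem hlt.1 hlt.2 h'.1)

/-- Every one of the m diagonals is met: by the top cell of a column or by the cell reached by a
step down, according to the side of the shuffle on which j lies. -/
theorem exists_cell (j : Fin m) :
    ∃ r c, (r, c) ∈ R.cells ∧ c + R.1.colLen 0 = j + r + 1 := by
  rcases R.shuffle.cover j with ⟨i, hi⟩ | ⟨r, hr⟩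
  · have h1 := R.colLen_le i
    have h2 := R.colLen_pos_of_lt i.isLt
    refine ⟨R.1.colLen i - 1, i, ?_, ?_⟩
    · rw [mem_cells_iff, YoungDiagram.mem_iff_lt_colLen, YoungDiagram.mem_iff_lt_colLen]
      have := R.1.colLen_anti i (i + 1) (Nat.le_succ _)
      omega
    · rw [← hi, shuffle_a]
      omega
  · have h1 := r.isLt
    have h2 : 0 < R.1.rowLen (r + 1) := lt_colLen_iff_lt_rowLen.1 (by omega)
    refine ⟨r, R.1.rowLen (r + 1) - 1, ?_, ?_⟩
    · rw [mem_cells_iff, YoungDiagram.mem_iff_lt_rowLen, YoungDiagram.mem_iff_lt_rowLen]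
      have := R.1.rowLen_anti r (r + 1) (Nat.le_succ _)
      omega
    · rw [← hr, shuffle_b]
      omega

/-- The content c - r increases by one along the reading order. Shifted by ℓ(λ) - 1, it maps the
cells up to a given one bijectively onto an initial segment of the naturals. -/
theorem label_eq {r c : ℕ} (h : (r, c) ∈ R.cells) : R.label (r, c) = c + R.1.colLen 0 - r := by
  have hmem := (R.mem_cells_iff.1 h).1
  have hlt := R.lt_of_mem hmem
  have hsize := R.size_eq
  rw [label, ← Finset.card_range (c + R.1.colLen 0 - r)]
  refine Finset.card_bij (fun x _ => x.2 + R.1.colLen 0 - x.1 - 1) ?_ ?_ ?_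
  · rintro ⟨r', c'⟩ hx
    rw [Finset.mem_filter] at hx
    obtain ⟨hx, hle⟩ := hx
    simp only at hle
    have h1 := R.not_lt_lt hx h
    have h2 := R.lt_of_mem (R.mem_cells_iff.1 hx).1
    rw [Finset.mem_range]
    simp only
    omega
  · rintro ⟨r₁, c₁⟩ h₁ ⟨r₂, c₂⟩ h₂ heq
    have h₁ := (Finset.mem_filter.1 h₁).1
    have h₂ := (Finset.mem_filter.1 h₂).1
    have e₁ := R.not_lt_lt h₁ h₂
    have e₂ := R.not_lt_lt h₂ h₁
    have l₁ := R.lt_of_mem (R.mem_cells_iff.1 h₁).1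
    have l₂ := R.lt_of_mem (R.mem_cells_iff.1 h₂).1
    simp only at heq
    rw [Prod.mk.injEq]
    omega
  · intro j hj
    rw [Finset.mem_range] at hj
    obtain ⟨r', c', hx, he⟩ := R.exists_cell ⟨j, by omega⟩
    simp only at he
    have e₁ := R.not_lt_lt h hx
    have l₁ := R.lt_of_mem (R.mem_cells_iff.1 hx).1
    refine ⟨(r', c'), Finset.mem_filter.2 ⟨hx, ?_⟩, ?_⟩
    · simp only
      omega
    · simp only
      omega

/-- The one-based label of the upper cell of a step down is the zero-based position of the lower
one, so no shift appears. -/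
theorem descents_eq : R.descents = Finset.univ.image fun r => (R.shuffle.b r : ℕ) := by
  ext x
  rw [descents, Finset.mem_image, Finset.mem_image]
  constructor
  · rintro ⟨⟨r, c⟩, hx, rfl⟩
    rw [Finset.mem_filter] at hx
    obtain ⟨h, ⟨r', c'⟩, h', hl, hlt⟩ := hx
    simp only at hlt
    rw [R.label_eq h, R.label_eq h'] at hl
    have e := R.not_lt_lt h' h
    have l := R.lt_of_mem (R.mem_cells_iff.1 h).1
    obtain rfl : c' = c := by omega
    obtain rfl : r = r' + 1 := by omega
    have h1 := (R.mem_cells_iff.1 h).1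
    have h2 := (R.mem_cells_iff.1 h').2
    rw [YoungDiagram.mem_iff_lt_rowLen] at h1 h2
    refine ⟨⟨r', by omega⟩, Finset.mem_univ _, ?_⟩
    rw [shuffle_b, R.label_eq h]
    simp only
    omega
  · rintro ⟨r, -, rfl⟩
    have h1 := r.isLt
    have h2 : 0 < R.1.rowLen (r + 1) := lt_colLen_iff_lt_rowLen.1 (by omega)
    have h3 := R.1.rowLen_anti r (r + 1) (Nat.le_succ _)
    have h4 := R.1.rowLen_anti (r + 1) (r + 1 + 1) (Nat.le_succ _)
    have hc : ((r : ℕ) + 1, R.1.rowLen (r + 1) - 1) ∈ R.cells := by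
      rw [mem_cells_iff, YoungDiagram.mem_iff_lt_rowLen, YoungDiagram.mem_iff_lt_rowLen]
      omega
    have hc' : ((r : ℕ), R.1.rowLen (r + 1) - 1) ∈ R.cells := by
      rw [mem_cells_iff, YoungDiagram.mem_iff_lt_rowLen, YoungDiagram.mem_iff_lt_rowLen]
      omega
    refine ⟨_, Finset.mem_filter.2 ⟨hc, _, hc', ?_, Nat.lt_succ_self _⟩, ?_⟩
    · rw [R.label_eq hc, R.label_eq hc']
      omega
    · rw [R.label_eq hc, shuffle_b]
      omega

/-- The positions 0, …, m - 1 sum to binom(m, 2), and those outside A sum to maj. -/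
theorem comaj_eq : R.comaj = ∑ x ∈ R.shuffle.A, (x : ℕ) := by
  have h1 : R.maj = ∑ r, (R.shuffle.b r : ℕ) := by
    rw [maj, descents_eq, Finset.sum_image]
    intro r _ s _ h
    exact R.shuffle.b_anti.injective (Fin.ext h)
  have h2 : ∑ x ∈ R.shuffle.A, (x : ℕ) = ∑ i, (R.shuffle.a i : ℕ) := by
    rw [Shuffle.A, Finset.sum_image]
    exact fun i _ j _ h => R.shuffle.a_mono.injective h
  have h3 : ∑ x : Fin m, (x : ℕ) = ∑ i, (R.shuffle.a i : ℕ) + ∑ r, (R.shuffle.b r : ℕ) := by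
    rw [← (Equiv.ofBijective _ R.shuffle.bijective).sum_comp, Fintype.sum_sum_type]
    rfl
  rw [Fin.sum_univ_eq_sum_range (fun x => x), Finset.sum_range_id, ← Nat.choose_two_right] at h3
  rw [comaj, h1, h2, h3]
  omega

/-! ### The bijection between ribbons and subsets -/

theorem card_A : R.shuffle.A.card = R.1.rowLen 0 := by
  rw [Shuffle.A, Finset.card_image_of_injective _ R.shuffle.a_mono.injective, Finset.card_univ,
    Fintype.card_fin]

theorem mem_A {x : Fin m} :
    x ∈ R.shuffle.A ↔ ∃ i, i < R.1.rowLen 0 ∧ (x : ℕ) = i + R.1.colLen 0 - R.1.colLen i := by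
  rw [Shuffle.A, Finset.mem_image]
  constructor
  · rintro ⟨i, -, rfl⟩
    exact ⟨i, i.isLt, R.shuffle_a i⟩
  · rintro ⟨i, hi, hx⟩
    exact ⟨⟨i, hi⟩, Finset.mem_univ _, Fin.ext (by rw [hx, shuffle_a])⟩

/-- The cardinality of A is λ_1, and then m gives ℓ(λ). The increasing enumeration of A is unique,
and its i-th value i + ℓ(λ) - λ'_i returns the column length. -/
theorem eq_of_A_eq {R R' : Ribbon m} (h : R.shuffle.A = R'.shuffle.A) : R = R' := by
  have hk : R.1.rowLen 0 = R'.1.rowLen 0 :=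
    R.card_A.symm.trans ((congrArg Finset.card h).trans R'.card_A)
  have hl : R.1.colLen 0 = R'.1.colLen 0 := by
    have := R.size_eq; have := R'.size_eq; have := R.colLen_pos; have := R'.colLen_pos
    omega
  have hcast : StrictMono fun i : Fin (R.1.rowLen 0) => R'.shuffle.a (Fin.cast hk i) :=
    fun i j hij => R'.shuffle.a_mono hij
  have hrange : Set.range R.shuffle.a =
      Set.range fun i : Fin (R.1.rowLen 0) => R'.shuffle.a (Fin.cast hk i) := by
    have h1 : Set.range R.shuffle.a = (R.shuffle.A : Set (Fin m)) := by
      rw [Shuffle.A, Finset.coe_image, Finset.coe_univ, Set.image_univ]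
    have h2 : Set.range R'.shuffle.a = (R'.shuffle.A : Set (Fin m)) := by
      rw [Shuffle.A, Finset.coe_image, Finset.coe_univ, Set.image_univ]
    rw [h1, h, ← h2]
    exact ((finCongr hk).surjective.range_comp R'.shuffle.a).symm
  have hfun := (R.shuffle.a_mono.range_inj hcast).1 hrange
  refine Subtype.ext (SetLike.ext fun c => ?_)
  obtain ⟨r, c⟩ := c
  rw [YoungDiagram.mem_iff_lt_colLen, YoungDiagram.mem_iff_lt_colLen]
  suffices hcol : R.1.colLen c = R'.1.colLen c by rw [hcol]
  by_cases hc : c < R.1.rowLen 0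
  · have h1 := congrArg Fin.val (congrFun hfun ⟨c, hc⟩)
    simp only [shuffle_a, Fin.val_cast] at h1
    have := R.colLen_le c
    have := R'.colLen_le c
    omega
  · have h1 : R.1.colLen c = 0 := by
      by_contra h0
      exact hc (lt_colLen_iff_lt_rowLen.1 (Nat.pos_of_ne_zero h0))
    have h2 : R'.1.colLen c = 0 := by
      by_contra h0
      exact hc (hk ▸ lt_colLen_iff_lt_rowLen.1 (Nat.pos_of_ne_zero h0))
    rw [h1, h2]

theorem zero_mem_A (hm : 0 < m) : (⟨0, hm⟩ : Fin m) ∈ R.shuffle.A := by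
  rw [mem_A]
  exact ⟨0, R.rowLen_pos, by simp⟩

/-- The formula for the i-th element forces λ'_i = i + (m + 1 - |A|) - a_i with ℓ(λ) = m + 1 - |A|;
one checks that these are the column lengths of a partition. -/
theorem exists_A_eq (A : Finset (Fin m)) (hm : 0 < m) (hA : (⟨0, hm⟩ : Fin m) ∈ A) :
    ∃ R : Ribbon m, R.shuffle.A = A := by
  have hk : 0 < A.card := Finset.card_pos.2 ⟨_, hA⟩
  have hkm : A.card ≤ m := by simpa using A.card_le_univ
  set a := A.orderEmbOfFin rfl with ha
  -- The enumeration grows by at least one per step, so the proposed column lengths decrease weakly.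
  have hstep : ∀ i j : Fin A.card, i ≤ j → (a i : ℕ) + (j - i : ℕ) ≤ a j := by
    intro i j hij
    obtain ⟨d, hd⟩ : ∃ d, (j : ℕ) = i + d := ⟨j - i, by have : (i : ℕ) ≤ j := hij; omega⟩
    induction d generalizing j with
    | zero =>
      obtain rfl : i = j := Fin.ext (by omega)
      simp
    | succ d ih =>
      have hj := j.isLt
      have h1 := ih ⟨i + d, by omega⟩ (by rw [Fin.le_def]; simp) rfl
      have h2 : a ⟨i + d, by omega⟩ < a j := a.strictMono (by rw [Fin.lt_def]; simp; omega)
      rw [Fin.lt_def] at h2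
      simp only at h1
      omega
  -- There must be room for the remaining elements below m; this makes all proposed column lengths
  -- positive.
  have hupper : ∀ i : Fin A.card, (a i : ℕ) + (A.card - i) ≤ m := by
    intro i
    have hi := i.isLt
    have h1 := hstep i ⟨A.card - 1, by omega⟩ (by rw [Fin.le_def]; simp only; omega)
    have h2 := (a ⟨A.card - 1, by omega⟩).isLt
    simp only at h1
    omega
  -- The condition 0 ∈ A is used here: it gives the first column its required length m + 1 - |A|.
  have hzero : a ⟨0, hk⟩ = ⟨0, hm⟩ := by
    have h1 : (⟨0, hm⟩ : Fin m) ∈ Set.range a := by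
      rw [ha, Finset.range_orderEmbOfFin]; exact hA
    obtain ⟨i, hi⟩ := h1
    have h2 : a ⟨0, hk⟩ ≤ a i := a.monotone (by rw [Fin.le_def]; simp)
    rw [hi, Fin.le_def] at h2
    exact Fin.ext (by simpa using h2)
  set w : List ℕ := List.ofFn fun i : Fin A.card => i + (m + 1 - A.card) - a i with hw
  have hlen : w.length = A.card := List.length_ofFn
  have hsorted : w.SortedGE := by
    rw [hw, List.sortedGE_ofFn_iff]
    intro i j hij
    have := hstep i j hij
    have := hupper i
    have := hupper j
    have : (i : ℕ) ≤ j := hij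
    simp only
    omega
  have hpos : ∀ x ∈ w, 0 < x := by
    intro x hx
    obtain ⟨i, rfl⟩ := (List.mem_ofFn' _ _).1 hx
    have := hupper i
    have := i.isLt
    simp only
    omega
  set μ := (YoungDiagram.ofRowLens w hsorted).transpose with hμ
  have hcol : ∀ i : Fin A.card, μ.colLen i = i + (m + 1 - A.card) - a i := by
    intro i
    have h1 := YoungDiagram.rowLen_ofRowLens (hw := hsorted) (Fin.cast hlen.symm i)
    rw [hμ, YoungDiagram.colLen_transpose]
    simp only [Fin.val_cast] at h1
    rw [h1]
    simp [hw]
  have hrow : μ.rowLen 0 = A.card := by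
    rw [hμ, YoungDiagram.rowLen_transpose, ← YoungDiagram.length_rowLens,
      YoungDiagram.rowLens_length_ofRowLens hpos, hlen]
  have hcol0 : μ.colLen 0 = m + 1 - A.card := by
    have := hcol ⟨0, hk⟩
    rw [hzero] at this
    simpa using this
  have hbot : μ ≠ ⊥ := by
    intro h
    have h1 : (0, 0) ∈ μ := YoungDiagram.mem_iff_lt_rowLen.2 (by rw [hrow]; exact hk)
    rw [h] at h1
    exact YoungDiagram.notMem_bot _ h1
  have hsize : μ.rowLen 0 + μ.colLen 0 - 1 = m := by
    rw [hrow, hcol0]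
    omega
  refine ⟨(⟨μ, hbot, hsize⟩ : Ribbon m), ?_⟩
  · ext x
    refine (Ribbon.mem_A _).trans ?_
    change (∃ i, i < μ.rowLen 0 ∧ (x : ℕ) = i + μ.colLen 0 - μ.colLen i) ↔ _
    rw [hrow, hcol0]
    have hx : x ∈ A ↔ ∃ i, a i = x := by
      rw [← Set.mem_range, ha, Finset.range_orderEmbOfFin]; rfl
    rw [hx]
    constructor
    · rintro ⟨i, hi, he⟩
      refine ⟨⟨i, hi⟩, Fin.ext ?_⟩
      have h1 := hcol ⟨i, hi⟩
      have h2 := hupper ⟨i, hi⟩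
      simp only at h1 h2
      rw [he, h1]
      omega
    · rintro ⟨i, rfl⟩
      refine ⟨i, i.isLt, ?_⟩
      have h2 := hupper i
      have := i.isLt
      rw [hcol]
      omega

end Ribbon

/-! ### The operator `H^t_{1^m}` -/

theorem prod_one_sub_smul {ι R A : Type*} [Fintype ι] [CommRing R] [CommRing A] [Algebra R A]
    (c : ι → R) (x : ι → A) : ∏ i, (1 - c i • x i) =
      ∑ s : Finset ι, ((-1) ^ s.card * ∏ i ∈ s, c i) • ∏ i ∈ s, x i := by
  classical
  have h : ∀ i, 1 - c i • x i = 1 + (-c i) • x i := fun i => by rw [neg_smul, sub_eq_add_neg]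
  rw [Finset.prod_congr rfl fun i _ => h i, Finset.prod_one_add, Finset.powerset_univ]
  refine Finset.sum_congr rfl fun s _ => ?_
  rw [Finset.prod_smul, Finset.prod_neg]

section Column

attribute [local instance] symFnRing symFnNeg symFnSub

variable {K : Type*} [Field K] [CharZero K] {m : ℕ}

/-- The coefficient of `z_1 ⋯ z_m` in `P[X + Z^*] ∏_{i ∈ A} Ω[-z_i X] ∏_{i < j} (1 - z_j / z_i)`. -/
noncomputable def subsetCoeff (A : Finset (Fin m)) (P : SymFn K) : SymFn K :=
  (plethAddInv K Finset.univ P * (∏ x ∈ A, OmegaNeg K (zExp x) (zExp_pos x)) *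
    ∏ x, ∏ y ∈ Finset.Ioi x, (1 - HahnSeries.single (zExp y - zExp x) 1)).coeff (fun _ => 1)

theorem ribbonOp_eq (R : Ribbon m) (P : SymFn K) :
    ribbonOp R P = (-1 : K) ^ R.shuffle.A.card • subsetCoeff R.shuffle.A P := by
  -- Rows of λ of length one become empty in λ^rc, so its Jacobi–Trudi determinant may need padding
  -- to size ℓ(λ) - 1.
  have hc : (rc R.1).colLen 0 ≤ R.1.colLen 0 - 1 := by
    rw [colLen_rc]
    exact Nat.sub_le_sub_right (R.colLen_le 1) 1
  have hmat : (Matrix.of fun r s : Fin (R.1.colLen 0 - 1) =>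
      hInt K (((rc R.1).rowLen r : ℤ) - ((r : ℕ) : ℤ) + ((s : ℕ) : ℤ))) =
      Matrix.of fun r s : Fin (R.1.colLen 0 - 1) => hInt K
        (((Finset.univ.filter fun i => R.shuffle.a i < R.shuffle.b r).card : ℤ) - 1
          - ((r : ℕ) : ℤ) + ((s : ℕ) : ℤ)) := by
    ext r s : 2
    have h : 0 < R.1.rowLen (r + 1) := lt_colLen_iff_lt_rowLen.1 (by have := r.isLt; omega)
    rw [Matrix.of_apply, Matrix.of_apply, R.card_filter_a_lt, rowLen_rc, Nat.cast_sub h,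
      Nat.cast_one]
  have hlist : R.1.transpose.rowLens = List.ofFn fun i : Fin (R.1.rowLen 0) =>
      1 + (Finset.univ.filter fun r => R.shuffle.a i < R.shuffle.b r).card := by
    rw [rowLens_transpose]
    exact congrArg List.ofFn (funext fun i => (R.card_filter_lt_b i).symm)
  rw [ribbonOp, schur_eq_det _ _ hc, hmat, hlist, R.card_A]
  -- The column lengths are cast to integers by a monadic lift of the list; the cast is moved inside
  -- the fold.
  rw [bind_pure_comp, List.map_eq_map, List.foldr_map]
  exact R.shuffle.skew_det_foldr_STilde P

/-- The exponents in which the first variable is not positive. -/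
def firstNonpos (hm : 0 < m) : AddSubmonoid (Fin m → ℤ) where
  carrier := {g | g ⟨0, hm⟩ ≤ 0}
  zero_mem' := Set.mem_ofPred.2 le_rfl
  add_mem' := fun hg hh => Set.mem_ofPred.2 (add_nonpos (Set.mem_ofPred.1 hg) (Set.mem_ofPred.1 hh))

theorem mem_firstNonpos {hm : 0 < m} {g : Fin m → ℤ} : g ∈ firstNonpos hm ↔ g ⟨0, hm⟩ ≤ 0 :=
  Set.mem_ofPred

/-- No factor contains a positive power of the first variable: it occurs in P[X+Z^*] and in the pair
factors only inverted, and its Ω is missing. -/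
theorem subsetCoeff_eq_zero (hm : 0 < m) {A : Finset (Fin m)} (hA : (⟨0, hm⟩ : Fin m) ∉ A)
    (P : SymFn K) : subsetCoeff A P = 0 := by
  have hz : ∀ i : Fin m, (0 : ℤ) ≤ zExp i ⟨0, hm⟩ := fun i => (zExp_pos i).le _
  have hz0 : ∀ i : Fin m, i ≠ ⟨0, hm⟩ → zExp i ⟨0, hm⟩ = 0 := fun i hi =>
    Pi.single_eq_of_ne (Ne.symm hi) _
  have hmem : plethAddInv K Finset.univ P * (∏ x ∈ A, OmegaNeg K (zExp x) (zExp_pos x)) *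
      ∏ x : Fin m, ∏ y ∈ Finset.Ioi x, (1 - HahnSeries.single (zExp y - zExp x) 1) ∈
        suppIn K (firstNonpos hm) := by
    refine mul_mem (mul_mem (pleth_mem (A := HahnSeries (Fin m → ℤ) (SymFn K)) _ (fun k => ?_) P)
      (prod_mem fun x hx => ?_)) (prod_mem fun x _ => prod_mem fun y hy => ?_)
    · refine add_mem (single_mem_suppIn (zero_mem _) _) (sum_mem fun i _ =>
        single_mem_suppIn ?_ _)
      exact mem_firstNonpos.2 (neg_nonpos.2 (nsmul_nonneg (hz i) _))
    · exact OmegaNeg_mem_suppIn _ (mem_firstNonpos.2 (hz0 x fun h => hA (h ▸ hx)).le)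
    · refine sub_mem (one_mem _) (single_mem_suppIn ?_ _)
      have hy0 : y ≠ ⟨0, hm⟩ := by
        rintro rfl
        exact Nat.not_lt_zero _ (Fin.lt_def.1 (Finset.mem_Ioi.1 hy))
      rw [mem_firstNonpos]
      change zExp y ⟨0, hm⟩ - zExp x ⟨0, hm⟩ ≤ 0
      rw [hz0 y hy0, zero_sub]
      exact neg_nonpos.2 (hz x)
  by_contra h
  exact absurd (hmem _ h) (by rw [mem_firstNonpos]; norm_num)

/-- Ribbons are exchanged for the subsets containing the first variable; the remaining subsets
contribute zero and may be added freely. -/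
theorem columnOp_eq_sum (t : K) (hm : 0 < m) (P : SymFn K) :
    columnOp t m P = ∑ A : Finset (Fin m),
      ((-1) ^ A.card * ∏ i ∈ A, t ^ (i : ℕ)) • subsetCoeff A P := by
  classical
  have h : ∀ R : Ribbon m, t ^ R.comaj • ribbonOp R P =
      ((-1) ^ R.shuffle.A.card * ∏ i ∈ R.shuffle.A, t ^ (i : ℕ)) •
        subsetCoeff R.shuffle.A P := by
    intro R
    rw [ribbonOp_eq, R.comaj_eq, smul_smul, Finset.prod_pow_eq_pow_sum, mul_comm]
  rw [columnOp, Finset.sum_congr rfl fun R _ => h R,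
    ← Finset.sum_filter_of_ne (p := fun A : Finset (Fin m) => (⟨0, hm⟩ : Fin m) ∈ A)]
  · refine Finset.sum_bij (fun R _ => R.shuffle.A) (fun R _ => ?_) (fun R _ R' _ hR => ?_)
      (fun A hA => ?_) (fun R _ => rfl)
    · exact Finset.mem_filter.2 ⟨Finset.mem_univ _, R.zero_mem_A hm⟩
    · exact Ribbon.eq_of_A_eq hR
    · obtain ⟨R, hR⟩ := Ribbon.exists_A_eq A hm (Finset.mem_filter.1 hA).2
      exact ⟨R, Finset.mem_univ _, hR⟩
  · intro A _ hA
    by_contra h0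
    exact hA (by rw [subsetCoeff_eq_zero hm h0, smul_zero])

end Column

theorem columnOp_eq_coeff {K : Type*} [Field K] [CharZero K] {m : ℕ} (t : K) (hm : 0 < m) (P : SymFn K) :
    columnOp t m P = (plethAddZStar m P *
      (∏ i : Fin m, (1 - t ^ (i : ℕ) • OmegaNeg K (zExp i) (zExp_pos i))) *
      (∏ i : Fin m, ∏ j ∈ Finset.Ioi i, (1 - HahnSeries.single (zExp j - zExp i) 1))).coeff
        (fun _ => 1) := by
  have h : ∏ i : Fin m, (1 - t ^ (i : ℕ) • OmegaNeg K (zExp i) (zExp_pos i)) = _ :=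
    prod_one_sub_smul (fun i : Fin m => t ^ (i : ℕ)) fun i => OmegaNeg K (zExp i) (zExp_pos i)
  rw [columnOp_eq_sum t hm, h, Finset.mul_sum, Finset.sum_mul,
    HahnSeries.coeff_sum]
  refine Finset.sum_congr rfl fun A _ => ?_
  rw [mul_smul_comm, smul_mul_assoc, HahnSeries.coeff_smul]
  rfl

end RibbonOperators

open RibbonOperators in
theorem mainTheorem6 {K : Type*} [Field K] [CharZero K] (t : K) (m : ℕ) (hm : 1 ≤ m)
    (P : SymFn K) :
    columnOp t m P =
      (plethAddZStar m P *
        (∏ i : Fin m, (1 - t ^ (i : ℕ) • OmegaNeg K (zExp i) (zExp_pos i))) *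
        (∏ i : Fin m, ∏ j ∈ Finset.Ioi i, (1 - HahnSeries.single (zExp j - zExp i) 1))).coeff
          (fun _ => 1) :=
  columnOp_eq_coeff t hm P
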